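/- Let $n\ge 1$, let $\mathrm{Sp}_{2n}(\mathbb R)$ be the real symplectic group with elements $g=\begin{pmatrix}A&B\\C&D\end{pmatrix}$ ($n\times n$ blocks), acting by $g.z=(Az+B)(Cz+D)^{-1}$ on $\mathcal H_n=\{z=x+iy\in M_n(\mathbb C): z^\top=z,\ y>0\}$, and let $K=\mathrm{Sp}_{2n}(\mathbb R)\cap \mathrm U(2n)$. Let $(\rho,V)$ be an irreducible polynomial representation of $\mathrm{GL}_n(\mathbb C)$ on a finite-dimensional complex inner product space $V$ (inner product linear in the first variable) such that $\rho|_{\mathrm U(n)}$ is unitary, let $\omega=(\omega_1\ge\dots\ge\omega_n)\in\mathbb Z^n$ be its highest weight, and assume $\omega_n>n$. Let $v^{top}\in V$ be a highest weight vector with $\|v^{top}\|=1$. For $f:\mathcal H_n\to V$ put $(f|_\rho g)(z)=\rho(Cz+D)^{-1}f(g.z)$, and let $F_f:\mathrm{Sp}_{2n}(\mathbb R)\to V$, $F_f(g)=(f|_\rho g)(iI_n)$, be its classical lift. Let $\mathcal H^2(\rho)$ be the space of holomorphic $f:\mathcal H_n\to V$ with $\int_{\mathcal H_n}\|\rho(y^{1/2})f(z)\|^2\,d\mathsf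 v(z)<\infty$, with inner product $\langle f_1,f_2\rangle=\int_{\mathcal H_n}\langle\rho(y^{1/2})f_1(z),\rho(y^{1/2})f_2(z)\rangle\,d\mathsf v(z)$, where $d\mathsf v(x+iy)=\det y^{-n-1}\prod_{r\le s}dx_{r,s}\,dy_{r,s}$. For $v\in V$ let $f_{1,v}(z)=\rho\big(\tfrac1{2i}(z+iI_n)\big)^{-1}v$. Then $\pi_\rho(g)f=f|_\rho g^{-1}$ defines a representation $\pi_\rho$ of $\mathrm{Sp}_{2n}(\mathbb R)$ on $\mathcal H^2(\rho)$ by surjective linear isometries, and for every $v\in V$ the function $f_{1,v}$ is a $K$-finite element of $\mathcal H^2(\rho)$. Let $\pi_\rho^*$ be the contragredient representation on the dual Hilbert space $\mathcal H^2(\rho)^*$, given by $\pi_\rho^*(g)\varphi=\varphi\circ\pi_\rho(g^{-1})$, and write $f^*=\langle\,\cdot\,,f\rangle\in\mathcal H^2(\rho)^*$. Put $C_\rho=\|f_{1,v^{top}}\|_{\mathcal H^2(\rho)}^2$. Then for every $K$-finite $f\in\mathcal H^2(\rho)$ (i.e. such that $\pi_\rho(K)f$ spans a finite-dimensional space), every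 $v\in V$ and every $g\in\mathrm{Sp}_{2n}(\mathbb R)$: (i) $c_{f,f_{1,v}}(g):=\langle\pi_\rho(g)f,f_{1,v}\rangle_{\mathcal H^2(\rho)}=C_\rho\,\langle F_f(g^{-1}),v\rangle$; (ii) $c_{f_{1,v}^*,f^*}(g):=\langle\pi_\rho^*(g)f_{1,v}^*,f^*\rangle_{\mathcal H^2(\rho)^*}=C_\rho\,\langle F_f(g),v\rangle$. -/

import Mathlib

open MeasureTheory Matrix
open scoped ComplexOrder MatrixOrder MatrixGroups

noncomputable section

/-! ### The Siegel upper half-space and its coordinates -/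

/-- Entrywise imaginary part of a complex matrix. -/
def imPart {n : ℕ} (z : Matrix (Fin n) (Fin n) ℂ) : Matrix (Fin n) (Fin n) ℝ :=
  z.map Complex.im

/-- Entrywise inclusion of real matrices into complex matrices. -/
def toC {n : ℕ} (y : Matrix (Fin n) (Fin n) ℝ) : Matrix (Fin n) (Fin n) ℂ :=
  y.map (algebraMap ℝ ℂ)

/-- The Siegel upper half-space of degree `n`: symmetric complex `n × n` matrices `z = x + iy`
with `y` positive definite. -/
def SiegelSpace (n : ℕ) : Type :=
  {z : Matrix (Fin n) (Fin n) ℂ // z.IsSymm ∧ (imPart z).PosDef}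

/-- The coordinates `(z_{r,s})_{r ≤ s}` of a point of the Siegel upper half-space, indexed by the
unordered pairs `{r, s}`. -/
def siegelCoord {n : ℕ} (z : SiegelSpace n) : Sym2 (Fin n) → ℂ :=
  Sym2.lift ⟨fun r s => z.1 r s, fun r s => z.2.1.apply s r⟩

/-- The Borel structure of the Siegel upper half-space, pulled back through the coordinates. -/
instance instMeasurableSpaceSiegel (n : ℕ) : MeasurableSpace (SiegelSpace n) :=
  MeasurableSpace.comap siegelCoord inferInstance

/-- The measure `dv(x+iy) = det(y)^(-n-1) ∏_{r ≤ s} dx_{r,s} dy_{r,s}`. -/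
def siegelMeasure (n : ℕ) : Measure (SiegelSpace n) :=
  (Measure.comap siegelCoord volume).withDensity
    fun z => ENNReal.ofReal ((imPart z.1).det ^ (-((n : ℤ) + 1)))

/-- A function on the Siegel upper half-space is holomorphic if it is a holomorphic function of
the coordinates `z_{r,s}`, `r ≤ s`, on the (open) range of the coordinates. -/
def IsHolomorphic {n : ℕ} {V : Type*} [NormedAddCommGroup V] [NormedSpace ℂ V]
    (f : SiegelSpace n → V) : Prop :=
  DifferentiableOn ℂ (Function.extend siegelCoord f 0) (Set.range (siegelCoord (n := n)))

theorem siegelCoord_injective (n : ℕ) : Function.Injective (siegelCoord (n := n)) := by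
  intro z w h
  apply Subtype.ext
  ext r s
  exact congrFun h s(r, s)

theorem isOpen_range_siegelCoord (n : ℕ) : IsOpen (Set.range (siegelCoord (n := n))) := by
  have hcont : Continuous fun p : (Sym2 (Fin n) → ℂ) × (Fin n → ℝ) =>
      p.2 ⬝ᵥ ((Matrix.of fun r s => (p.1 s(r, s)).im) *ᵥ p.2) := by
    simp only [dotProduct, mulVec, Matrix.of_apply]
    fun_prop
  have key : Set.range (siegelCoord (n := n)) =
      {c | ∀ x ∈ Metric.sphere (0 : Fin n → ℝ) 1,
        0 < x ⬝ᵥ ((Matrix.of fun r s => (c s(r, s)).im) *ᵥ x)} := by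
    ext c
    constructor
    · rintro ⟨z, rfl⟩ x hx
      have hx0 : x ≠ 0 := by
        rintro rfl
        simp at hx
      exact z.2.2.dotProduct_mulVec_pos hx0
    · intro hc
      refine ⟨⟨Matrix.of fun r s => c s(r, s), ?_, ?_⟩, ?_⟩
      · ext r s
        simp [Sym2.eq_swap]
      · refine PosDef.of_dotProduct_mulVec_pos ?_ ?_
        · ext r s
          simp [imPart, Sym2.eq_swap]
        · intro x hx
          have hn : 0 < ‖x‖ := norm_pos_iff.2 hx
          have h1 := hc (‖x‖⁻¹ • x) (by simp [norm_smul, hn.ne'])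
          rw [mulVec_smul, dotProduct_smul, smul_dotProduct, smul_eq_mul, smul_eq_mul,
            ← mul_assoc] at h1
          exact (pos_iff_pos_of_mul_pos h1).1 (by positivity)
      · funext p
        induction p using Sym2.ind with
        | _ r s => rfl
  rw [key, isOpen_iff_eventually]
  intro c hc
  refine (isCompact_sphere (0 : Fin n → ℝ) 1).eventually_forall_of_forall_eventually ?_
  intro x hx
  exact (hcont.tendsto (c, x)).eventually (lt_mem_nhds (hc x hx))

theorem measurableEmbedding_siegelCoord (n : ℕ) :
    MeasurableEmbedding (siegelCoord (n := n)) := by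
  refine ⟨siegelCoord_injective n, comap_measurable _, ?_⟩
  rintro _ ⟨t, ht, rfl⟩
  rw [Set.image_preimage_eq_inter_range]
  exact ht.inter (isOpen_range_siegelCoord n).measurableSet

/-! ### The action of the symplectic group -/

/-- The real symplectic group `Sp_{2n}(ℝ)`. -/
abbrev SpR (n : ℕ) : Type := symplecticGroup (Fin n) ℝ

/-- For `g = (A B; C D)` and `z`, the matrix `Az + B`. -/
def spNum {n : ℕ} (g : SpR n) (z : Matrix (Fin n) (Fin n) ℂ) : Matrix (Fin n) (Fin n) ℂ :=
  toC g.1.toBlocks₁₁ * z + toC g.1.toBlocks₁₂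

/-- For `g = (A B; C D)` and `z`, the matrix `Cz + D`. -/
def spDen {n : ℕ} (g : SpR n) (z : Matrix (Fin n) (Fin n) ℂ) : Matrix (Fin n) (Fin n) ℂ :=
  toC g.1.toBlocks₂₁ * z + toC g.1.toBlocks₂₂

theorem posDef_toC {n : ℕ} {y : Matrix (Fin n) (Fin n) ℝ} (hy : y.PosDef) : (toC y).PosDef := by
  have h1 := CFC.sqrt_mul_sqrt_self y hy.posSemidef.nonneg
  have h2 : (CFC.sqrt y)ᴴ = CFC.sqrt y :=
    (CFC.sqrt_nonneg y).posSemidef.isHermitian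
  have h3 : toC y = (toC (CFC.sqrt y))ᴴ * toC (CFC.sqrt y) := by
    have h4 : (toC (CFC.sqrt y))ᴴ = toC ((CFC.sqrt y)ᴴ) := by
      ext r s
      simp [toC]
    rw [h4, h2]
    conv_lhs => rw [← h1]
    exact Matrix.map_mul
  rw [h3]
  refine PosDef.conjTranspose_mul_self _ ?_
  apply Matrix.mulVec_injective_of_isUnit
  rw [Matrix.isUnit_iff_isUnit_det]
  have h5 : (toC (CFC.sqrt y)).det = ((CFC.sqrt y).det : ℂ) := by
    rw [toC, ← RingHom.mapMatrix_apply, ← RingHom.map_det]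
    rfl
  rw [h5, isUnit_iff_ne_zero]
  have h6 : (CFC.sqrt y).det * (CFC.sqrt y).det = y.det := by rw [← det_mul, h1]
  intro h
  have h7 : (CFC.sqrt y).det = 0 := by exact_mod_cast h
  rw [h7] at h6
  simp at h6
  exact hy.det_pos.ne h6

theorem posDef_of_toC {n : ℕ} {y : Matrix (Fin n) (Fin n) ℝ} (hy : (toC y).PosDef) :
    y.PosDef := by
  refine PosDef.of_dotProduct_mulVec_pos ?_ ?_
  · ext r s
    have := hy.isHermitian.apply r s
    simp [toC] at this
    simpa using this
  · intro x hx
    have h1 : (fun i => (x i : ℂ)) ≠ 0 := by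
      intro h
      apply hx
      funext i
      have h' : (x i : ℂ) = 0 := congrFun h i
      simpa using h'
    have h2 := hy.dotProduct_mulVec_pos h1
    have h3 : star (fun i => (x i : ℂ)) ⬝ᵥ (toC y *ᵥ fun i => (x i : ℂ)) =
        ((star x ⬝ᵥ (y *ᵥ x) : ℝ) : ℂ) := by
      simp [dotProduct, mulVec, toC]
    rw [h3] at h2
    exact_mod_cast h2

theorem sub_conjTranspose_of_isSymm {n : ℕ} {z : Matrix (Fin n) (Fin n) ℂ} (hz : z.IsSymm) :
    z - zᴴ = (2 * Complex.I) • toC (imPart z) := by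
  ext r s
  have h := hz.apply r s
  have e : (z - zᴴ) r s = z r s - star (z r s) := by
    rw [Matrix.sub_apply, conjTranspose_apply, h]
  rw [e]
  apply Complex.ext <;> simp [toC, imPart]
  ring

theorem sp_block_relations {n : ℕ} (g : SpR n) :
    (toC g.1.toBlocks₁₁)ᵀ * toC g.1.toBlocks₂₁ = (toC g.1.toBlocks₂₁)ᵀ * toC g.1.toBlocks₁₁ ∧
    (toC g.1.toBlocks₁₂)ᵀ * toC g.1.toBlocks₂₂ = (toC g.1.toBlocks₂₂)ᵀ * toC g.1.toBlocks₁₂ ∧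
    (toC g.1.toBlocks₁₁)ᵀ * toC g.1.toBlocks₂₂ - (toC g.1.toBlocks₂₁)ᵀ * toC g.1.toBlocks₁₂ = 1 := by
  have h := g.2
  rw [← fromBlocks_toBlocks g.1, SymplecticGroup.fromBlocks_mem_iff] at h
  obtain ⟨h1, h2, h3⟩ := h
  have hm : ∀ X Y : Matrix (Fin n) (Fin n) ℝ, (toC X)ᵀ * toC Y = toC (Xᵀ * Y) := by
    intro X Y
    simp only [toC, Matrix.map_mul, transpose_map]
  refine ⟨by rw [hm, hm, h1], by rw [hm, hm, h2], ?_⟩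
  rw [hm, hm]
  have : toC (g.1.toBlocks₁₁ᵀ * g.1.toBlocks₂₂) - toC (g.1.toBlocks₂₁ᵀ * g.1.toBlocks₁₂) =
      toC (g.1.toBlocks₁₁ᵀ * g.1.toBlocks₂₂ - g.1.toBlocks₂₁ᵀ * g.1.toBlocks₁₂) := by
    simp only [toC]
    exact (Matrix.map_sub _ (map_sub _) _ _).symm
  rw [this, h3]
  simp [toC]

theorem sp_symm_relation {n : ℕ} (g : SpR n) {z : Matrix (Fin n) (Fin n) ℂ} (hz : z.IsSymm) :
    (spDen g z)ᵀ * spNum g z = (spNum g z)ᵀ * spDen g z := by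
  obtain ⟨h1, h2, h3⟩ := sp_block_relations g
  have h4 := congrArg transpose h3
  simp only [transpose_sub, transpose_mul, transpose_transpose, transpose_one] at h4
  unfold spNum spDen
  generalize toC g.1.toBlocks₁₁ = A at *
  generalize toC g.1.toBlocks₁₂ = B at *
  generalize toC g.1.toBlocks₂₁ = C at *
  generalize toC g.1.toBlocks₂₂ = D at *
  simp only [transpose_add, transpose_mul, hz.eq]
  have e : (z * Aᵀ + Bᵀ) * (C * z + D) - (z * Cᵀ + Dᵀ) * (A * z + B) =
      z * (Aᵀ * C - Cᵀ * A) * z + z * (Aᵀ * D - Cᵀ * B) - (Dᵀ * A - Bᵀ * C) * z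
        + (Bᵀ * D - Dᵀ * B) := by noncomm_ring
  rw [h3, h4, h1, h2] at e
  simp only [sub_self, mul_zero, zero_mul, mul_one, one_mul, add_zero, zero_add] at e
  exact (sub_eq_zero.1 e).symm

theorem sp_herm_relation {n : ℕ} (g : SpR n) {z : Matrix (Fin n) (Fin n) ℂ} :
    (spDen g z)ᴴ * spNum g z - (spNum g z)ᴴ * spDen g z = z - zᴴ := by
  obtain ⟨h1, h2, h3⟩ := sp_block_relations g
  have h4 := congrArg transpose h3
  simp only [transpose_sub, transpose_mul, transpose_transpose, transpose_one] at h4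
  have hr : ∀ X : Matrix (Fin n) (Fin n) ℝ, (toC X)ᴴ = (toC X)ᵀ := by
    intro X
    ext r s
    simp [toC]
  unfold spNum spDen
  simp only [conjTranspose_add, conjTranspose_mul, hr]
  generalize toC g.1.toBlocks₁₁ = A at *
  generalize toC g.1.toBlocks₁₂ = B at *
  generalize toC g.1.toBlocks₂₁ = C at *
  generalize toC g.1.toBlocks₂₂ = D at *
  have e : (zᴴ * Cᵀ + Dᵀ) * (A * z + B) - (zᴴ * Aᵀ + Bᵀ) * (C * z + D) =
      (Dᵀ * A - Bᵀ * C) * z - zᴴ * (Aᵀ * C - Cᵀ * A) * z - zᴴ * (Aᵀ * D - Cᵀ * B)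
        - (Bᵀ * D - Dᵀ * B) := by noncomm_ring
  rw [e, h3, h4, h1, h2]
  simp

theorem det_spDen_ne_zero {n : ℕ} (g : SpR n) (z : SiegelSpace n) : (spDen g z.1).det ≠ 0 := by
  intro h
  obtain ⟨x, hx0, hx⟩ := Matrix.exists_mulVec_eq_zero_iff.2 h
  have h1 := sp_herm_relation g (z := z.1)
  rw [sub_conjTranspose_of_isSymm z.2.1] at h1
  have h2 := congrArg (fun M => star x ⬝ᵥ (M *ᵥ x)) h1
  have h3 : star x ᵥ* (spDen g z.1)ᴴ = 0 := by
    rw [← star_mulVec, hx, star_zero]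
  simp only [sub_mulVec, ← mulVec_mulVec, dotProduct_sub, hx, mulVec_zero, dotProduct_zero,
    dotProduct_mulVec _ (spDen g z.1)ᴴ, h3, zero_dotProduct, sub_self, smul_mulVec,
    dotProduct_smul, smul_eq_mul] at h2
  have h4 := (posDef_toC z.2.2).dotProduct_mulVec_pos hx0
  have h5 : (2 * Complex.I) ≠ 0 := by simp
  exact (mul_ne_zero h5 h4.ne') h2.symm

theorem sp_action_mem {n : ℕ} (g : SpR n) (z : SiegelSpace n) :
    (spNum g z.1 * (spDen g z.1)⁻¹).IsSymm ∧
      (imPart (spNum g z.1 * (spDen g z.1)⁻¹)).PosDef := by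
  have hu : IsUnit (spDen g z.1).det := isUnit_iff_ne_zero.2 (det_spDen_ne_zero g z)
  have e1 := sp_symm_relation g z.2.1
  have e2 := sp_herm_relation g (z := z.1)
  rw [sub_conjTranspose_of_isSymm z.2.1] at e2
  have hN := Matrix.mul_nonsing_inv _ hu
  generalize spDen g z.1 = N at *
  generalize spNum g z.1 = M at *
  have hNT : (N⁻¹)ᵀ * Nᵀ = 1 := by rw [← transpose_mul, hN, transpose_one]
  have hNH : (N⁻¹)ᴴ * Nᴴ = 1 := by rw [← conjTranspose_mul, hN, conjTranspose_one]
  have hs : (M * N⁻¹).IsSymm := by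
    have a : (N⁻¹)ᵀ * (Nᵀ * M) * N⁻¹ = (N⁻¹)ᵀ * (Mᵀ * N) * N⁻¹ := by rw [e1]
    rw [← mul_assoc, hNT, one_mul, mul_assoc, mul_assoc, hN, mul_one] at a
    rw [Matrix.IsSymm, transpose_mul]
    exact a.symm
  refine ⟨hs, posDef_of_toC ?_⟩
  have b := sub_conjTranspose_of_isSymm hs
  have c : M * N⁻¹ - (M * N⁻¹)ᴴ = (2 * Complex.I) • ((N⁻¹)ᴴ * toC (imPart z.1) * N⁻¹) := by
    have : (N⁻¹)ᴴ * (Nᴴ * M - Mᴴ * N) * N⁻¹ =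
        ((N⁻¹)ᴴ * Nᴴ) * (M * N⁻¹) - ((N⁻¹)ᴴ * Mᴴ) * (N * N⁻¹) := by noncomm_ring
    rw [hN, hNH, one_mul, mul_one, ← conjTranspose_mul, e2] at this
    rw [← this]
    simp
  rw [c] at b
  have d := smul_right_injective _ (show (2 * Complex.I) ≠ 0 by simp) b
  change (N⁻¹)ᴴ * toC (imPart z.1) * N⁻¹ = _ at d
  rw [← d]
  refine (posDef_toC z.2.2).conjTranspose_mul_mul_same ?_
  apply Matrix.mulVec_injective_of_isUnit
  exact (Matrix.isUnit_nonsing_inv_iff).2 ((Matrix.isUnit_iff_isUnit_det _).2 hu)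

/-- The action `g.z = (Az + B)(Cz + D)⁻¹`. -/
def spAct {n : ℕ} (g : SpR n) (z : SiegelSpace n) : SiegelSpace n :=
  ⟨spNum g z.1 * (spDen g z.1)⁻¹, sp_action_mem g z⟩

/-- The automorphy factor `Cz + D` as an element of `GL_n(ℂ)`. -/
def spFactor {n : ℕ} (g : SpR n) (z : SiegelSpace n) : GL (Fin n) ℂ :=
  GeneralLinearGroup.mkOfDetNeZero (spDen g z.1) (det_spDen_ne_zero g z)

theorem det_siegel_ne_zero {n : ℕ} (z : SiegelSpace n) : z.1.det ≠ 0 := by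
  have h := det_spDen_ne_zero (SymplecticGroup.symJ (Fin n) ℝ) z
  have e : spDen (SymplecticGroup.symJ (Fin n) ℝ) z.1 = z.1 := by
    simp [spDen, SymplecticGroup.coe_J, J, toC]
  rwa [e] at h

/-- The base point `i I_n`. -/
def siegelBase (n : ℕ) : SiegelSpace n :=
  ⟨Complex.I • (1 : Matrix (Fin n) (Fin n) ℂ), by simp [Matrix.IsSymm], by
    have : imPart (Complex.I • (1 : Matrix (Fin n) (Fin n) ℂ)) = 1 := by
      ext r s
      by_cases h : r = s <;> simp [imPart, Matrix.one_apply, h]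
    rw [this]
    exact PosDef.one⟩

/-- The translate `z + i I_n`, again a point of the Siegel upper half-space. -/
def siegelAddI {n : ℕ} (z : SiegelSpace n) : SiegelSpace n :=
  ⟨z.1 + Complex.I • 1, z.2.1.add (siegelBase n).2.1, by
    have : imPart (z.1 + Complex.I • 1) = imPart z.1 + imPart (siegelBase n).1 := by
      ext r s
      simp [imPart, siegelBase]
    rw [this]
    exact z.2.2.add (siegelBase n).2.2⟩

/-- The matrix `(1/2i)(z + i I_n)` as an element of `GL_n(ℂ)`. -/
def cayleyFactor {n : ℕ} (z : SiegelSpace n) : GL (Fin n) ℂ :=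
  GeneralLinearGroup.mkOfDetNeZero ((1 / (2 * Complex.I)) • (z.1 + Complex.I • 1)) (by
    rw [det_smul]
    exact mul_ne_zero (pow_ne_zero _ (by simp)) (det_siegel_ne_zero (siegelAddI z)))

/-- The positive definite square root `y^{1/2}` of `y = Im z`, as an element of `GL_n(ℂ)`. -/
def sqrtIm {n : ℕ} (z : SiegelSpace n) : GL (Fin n) ℂ :=
  GeneralLinearGroup.mkOfDetNeZero (toC (CFC.sqrt (imPart z.1))) (by
    have h1 := CFC.sqrt_mul_sqrt_self (imPart z.1) z.2.2.posSemidef.nonneg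
    have h5 : (toC (CFC.sqrt (imPart z.1))).det = ((CFC.sqrt (imPart z.1)).det : ℂ) := by
      rw [toC, ← RingHom.mapMatrix_apply, ← RingHom.map_det]
      rfl
    rw [h5]
    intro h
    have h7 : (CFC.sqrt (imPart z.1)).det = 0 := by exact_mod_cast h
    have h6 := congrArg Matrix.det h1
    rw [det_mul, h7, zero_mul] at h6
    exact z.2.2.det_pos.ne h6)

/-! ### Polynomial representations of `GL_n(ℂ)` -/

section Reps

variable {n : ℕ} {V : Type*} [NormedAddCommGroup V] [InnerProductSpace ℂ V]

/-- `ρ` is polynomial: its matrix coefficients are polynomials in the entries of `g`. -/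
def IsPolynomialRep (ρ : Representation ℂ (GL (Fin n) ℂ) V) : Prop :=
  ∀ (φ : Module.Dual ℂ V) (v : V), ∃ P : MvPolynomial (Fin n × Fin n) ℂ,
    ∀ g : GL (Fin n) ℂ, φ (ρ g v) = MvPolynomial.eval (fun p => g.1 p.1 p.2) P

/-- The restriction of `ρ` to `U(n)` is unitary. -/
def IsUnitaryOnUn (ρ : Representation ℂ (GL (Fin n) ℂ) V) : Prop :=
  ∀ u : GL (Fin n) ℂ, u.1 ∈ unitaryGroup (Fin n) ℂ →
    ∀ x y : V, inner ℂ (ρ u x) (ρ u y) = inner ℂ x y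

/-- `v` is a highest weight vector of weight `ω` for `ρ`: a nonzero vector on which the diagonal
matrices act through `diag(t) ↦ ∏ t_r ^ ω_r` and whose line is stable under the upper triangular
matrices. -/
structure IsHighestWeightVector (ρ : Representation ℂ (GL (Fin n) ℂ) V) (ω : Fin n → ℤ) (v : V) :
    Prop where
  ne_zero : v ≠ 0
  weight : ∀ (h : GL (Fin n) ℂ) (t : Fin n → ℂ), h.1 = diagonal t → ρ h v = (∏ r, t r ^ ω r) • v
  borel : ∀ b : GL (Fin n) ℂ, (∀ r s, s < r → b.1 r s = 0) → ∃ c : ℂ, ρ b v = c • v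

/-- The right action `(f|_ρ g)(z) = ρ(Cz + D)⁻¹ f(g.z)`. -/
def slash (ρ : Representation ℂ (GL (Fin n) ℂ) V) (f : SiegelSpace n → V) (g : SpR n) :
    SiegelSpace n → V :=
  fun z => ρ (spFactor g z)⁻¹ (f (spAct g z))

/-- The classical lift `F_f(g) = (f|_ρ g)(i I_n)`. -/
def classicalLift (ρ : Representation ℂ (GL (Fin n) ℂ) V) (f : SiegelSpace n → V) (g : SpR n) : V :=
  slash ρ f g (siegelBase n)

/-- The function `f_{μ,v}(z) = μ((z - iI)(z + iI)⁻¹) ρ((1/2i)(z + iI))⁻¹ v`. -/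
def siegelF (ρ : Representation ℂ (GL (Fin n) ℂ) V) (μ : MvPolynomial (Fin n × Fin n) ℂ) (v : V) :
    SiegelSpace n → V :=
  fun z => MvPolynomial.eval
    (fun p => ((z.1 - Complex.I • 1) * (z.1 + Complex.I • 1)⁻¹) p.1 p.2) μ •
      ρ (cayleyFactor z)⁻¹ v

/-! ### The space `H²(ρ)` -/

/-- The function `z ↦ ρ(y^{1/2}) f(z)`. -/
def weighted (ρ : Representation ℂ (GL (Fin n) ℂ) V) (f : SiegelSpace n → V) :
    SiegelSpace n → V :=
  fun z => ρ (sqrtIm z) (f z)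

/-- The space of holomorphic functions `f` with `∫ ‖ρ(y^{1/2}) f(z)‖² dv(z) < ∞`. -/
def H2Submodule (ρ : Representation ℂ (GL (Fin n) ℂ) V) : Submodule ℂ (SiegelSpace n → V) where
  carrier := {f | IsHolomorphic f ∧ MemLp (weighted ρ f) 2 (siegelMeasure n)}
  add_mem' := by
    rintro f g ⟨hf, hf'⟩ ⟨hg, hg'⟩
    constructor
    · have e : Function.extend siegelCoord (f + g) (0 : (Sym2 (Fin n) → ℂ) → V) =
          Function.extend siegelCoord f 0 + Function.extend siegelCoord g 0 := by
        rw [← Function.extend_add, add_zero]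
      unfold IsHolomorphic
      rw [e]
      exact hf.add hg
    · have e : weighted ρ (f + g) = weighted ρ f + weighted ρ g := by
        funext z
        simp [weighted]
      rw [e]
      exact hf'.add hg'
  zero_mem' := by
    constructor
    · have e : Function.extend siegelCoord (0 : SiegelSpace n → V)
          (0 : (Sym2 (Fin n) → ℂ) → V) = 0 := Function.extend_zero _
      unfold IsHolomorphic
      rw [e]
      exact differentiableOn_const 0
    · have e : weighted ρ (0 : SiegelSpace n → V) = 0 := by
        funext z
        simp [weighted]
      rw [e]
      exact MemLp.zero
  smul_mem' := by
    rintro c f ⟨hf, hf'⟩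
    constructor
    · have e : Function.extend siegelCoord (c • f) (0 : (Sym2 (Fin n) → ℂ) → V) =
          c • Function.extend siegelCoord f 0 := by
        rw [← Function.extend_smul, smul_zero]
      unfold IsHolomorphic
      rw [e]
      exact hf.const_smul c
    · have e : weighted ρ (c • f) = c • weighted ρ f := by
        funext z
        simp [weighted]
      rw [e]
      exact hf'.const_smul c

/-- The space `H²(ρ)`; the underlying function of `f : H2 ρ` is `f.1`. -/
def H2 (ρ : Representation ℂ (GL (Fin n) ℂ) V) : Type _ := ↥(H2Submodule ρ)

instance instAddCommGroupH2 (ρ : Representation ℂ (GL (Fin n) ℂ) V) : AddCommGroup (H2 ρ) :=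
  inferInstanceAs (AddCommGroup ↥(H2Submodule ρ))

instance instModuleH2 (ρ : Representation ℂ (GL (Fin n) ℂ) V) : Module ℂ (H2 ρ) :=
  inferInstanceAs (Module ℂ ↥(H2Submodule ρ))

theorem H2_add_val (ρ : Representation ℂ (GL (Fin n) ℂ) V) (f g : H2 ρ) :
    (f + g).1 = f.1 + g.1 := rfl

theorem H2_smul_val (ρ : Representation ℂ (GL (Fin n) ℂ) V) (c : ℂ) (f : H2 ρ) :
    (c • f).1 = c • f.1 := rfl

theorem eq_zero_of_weighted_ae_zero (ρ : Representation ℂ (GL (Fin n) ℂ) V)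
    {f : SiegelSpace n → V} (hf : IsHolomorphic f)
    (h : weighted ρ f =ᵐ[siegelMeasure n] 0) : f = 0 := by
  have h1 : ∀ᵐ z ∂(siegelMeasure n), f z = 0 := by
    filter_upwards [h] with z hz
    have e : ρ (sqrtIm z)⁻¹ (weighted ρ f z) = f z := by
      simp [weighted]
    rw [← e, hz]
    simp
  have hmeas : Measurable fun z : SiegelSpace n =>
      ENNReal.ofReal ((imPart z.1).det ^ (-((n : ℤ) + 1))) := by
    have hc : Measurable (siegelCoord (n := n)) := comap_measurable _
    have hent : ∀ r s, Measurable fun z : SiegelSpace n => (imPart z.1) r s := by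
      intro r s
      exact Complex.measurable_im.comp ((measurable_pi_apply s(r, s)).comp hc)
    have hdet : Measurable fun z : SiegelSpace n => (imPart z.1).det := by
      simp only [Matrix.det_apply]
      refine Finset.measurable_sum _ fun σ _ => ?_
      exact (Finset.measurable_prod _ fun i _ => hent _ _).const_smul _
    have hpow : Measurable fun x : ℝ => x ^ (-((n : ℤ) + 1)) := by
      have : ∀ x : ℝ, x ^ (-((n : ℤ) + 1)) = (x ^ (n + 1))⁻¹ := by
        intro x
        rw [_root_.zpow_neg]
        norm_cast
      simp only [this]
      fun_prop
    exact (hpow.comp hdet).ennreal_ofReal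
  unfold siegelMeasure at h1
  rw [ae_withDensity_iff hmeas] at h1
  have h2 : ∀ᵐ z ∂(Measure.comap (siegelCoord (n := n)) volume), f z = 0 := by
    filter_upwards [h1] with z hz
    apply hz
    rw [ne_eq, ENNReal.ofReal_eq_zero, not_le]
    exact zpow_pos z.2.2.det_pos _
  have h3 : ∀ᵐ c ∂(volume.restrict (Set.range (siegelCoord (n := n)))),
      Function.extend siegelCoord f 0 c = 0 := by
    rw [← (measurableEmbedding_siegelCoord n).map_comap,
      (measurableEmbedding_siegelCoord n).ae_map_iff]
    filter_upwards [h2] with z hz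
    rw [(siegelCoord_injective n).extend_apply, hz]
  have h4 := Measure.eqOn_open_of_ae_eq (f := Function.extend siegelCoord f 0) (g := fun _ => 0)
    h3 (isOpen_range_siegelCoord n) hf.continuousOn continuousOn_const
  funext z
  have h5 := h4 ⟨z, rfl⟩
  rwa [(siegelCoord_injective n).extend_apply] at h5

theorem integrable_inner_weighted (ρ : Representation ℂ (GL (Fin n) ℂ) V) (f g : H2 ρ) :
    Integrable (fun z => inner ℂ (weighted ρ f.1 z) (weighted ρ g.1 z)) (siegelMeasure n) := by
  refine (L2.integrable_inner (𝕜 := ℂ) f.2.2.toLp g.2.2.toLp).congr ?_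
  filter_upwards [f.2.2.coeFn_toLp, g.2.2.coeFn_toLp] with z h1 h2
  rw [h1, h2]

/-- The inner product `∫ ⟨ρ(y^{1/2}) f₁(z), ρ(y^{1/2}) f₂(z)⟩ dv(z)` of `H²(ρ)`, in Mathlib's
convention (conjugate linear in the first variable). -/
@[reducible] def H2core (ρ : Representation ℂ (GL (Fin n) ℂ) V) : InnerProductSpace.Core ℂ (H2 ρ) where
  inner f g := ∫ z, inner ℂ (weighted ρ f.1 z) (weighted ρ g.1 z) ∂(siegelMeasure n)
  conj_inner_symm f g := by
    rw [← integral_conj]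
    simp
  re_inner_nonneg f := by
    have e : ∀ z, inner ℂ (weighted ρ f.1 z) (weighted ρ f.1 z) =
        ((‖weighted ρ f.1 z‖ ^ 2 : ℝ) : ℂ) := by
      intro z
      rw [inner_self_eq_norm_sq_to_K]
      push_cast
      rfl
    simp only [e]
    rw [integral_complex_ofReal]
    simp only [RCLike.re_to_complex, Complex.ofReal_re]
    exact integral_nonneg fun z => by positivity
  add_left f g h := by
    rw [← integral_add (integrable_inner_weighted ρ f h) (integrable_inner_weighted ρ g h)]
    congr 1
    funext z
    simp [weighted, H2_add_val]
  smul_left f g c := by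
    rw [← integral_const_mul]
    congr 1
    funext z
    simp [weighted, H2_smul_val, mul_comm]
  definite f h := by
    have e : ∀ z, inner ℂ (weighted ρ f.1 z) (weighted ρ f.1 z) =
        ((‖weighted ρ f.1 z‖ ^ 2 : ℝ) : ℂ) := by
      intro z
      rw [inner_self_eq_norm_sq_to_K]
      push_cast
      rfl
    have hint := integrable_inner_weighted ρ f f
    simp only [e] at h hint
    have hint' : Integrable (fun z => ‖weighted ρ f.1 z‖ ^ 2) (siegelMeasure n) := hint.re
    rw [integral_complex_ofReal, Complex.ofReal_eq_zero,
      integral_eq_zero_iff_of_nonneg (fun z => by positivity) hint'] at h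
    apply Subtype.ext
    refine eq_zero_of_weighted_ae_zero ρ f.2.1 ?_
    filter_upwards [h] with z hz
    simpa using hz

instance instNormedAddCommGroupH2 (ρ : Representation ℂ (GL (Fin n) ℂ) V) :
    NormedAddCommGroup (H2 ρ) :=
  (H2core ρ).toNormedAddCommGroup

instance instInnerProductSpaceH2 (ρ : Representation ℂ (GL (Fin n) ℂ) V) :
    InnerProductSpace ℂ (H2 ρ) :=
  InnerProductSpace.ofCore (H2core ρ).toCore

theorem H2_inner_def (ρ : Representation ℂ (GL (Fin n) ℂ) V) (f g : H2 ρ) :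
    inner ℂ f g = ∫ z, inner ℂ (weighted ρ f.1 z) (weighted ρ g.1 z) ∂(siegelMeasure n) := rfl

end Reps

/-! ### Matrix coefficients -/

section Coefficients

variable {n : ℕ} {H : Type*} [NormedAddCommGroup H] [InnerProductSpace ℂ H]

/-- The maximal compact subgroup `K = Sp_{2n}(ℝ) ∩ U(2n)`: the orthogonal matrices in
`Sp_{2n}(ℝ)`. -/
def maxCompact (n : ℕ) : Set (SpR n) :=
  {k | k.1 ∈ orthogonalGroup (Fin n ⊕ Fin n) ℝ}

/-- `h` is `K`-finite: the linear span of `π(K)h` is finite-dimensional. (Smoothness of `h`, which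
for irreducible unitary representations follows from `K`-finiteness, is not imposed.) -/
def IsKFinite (π : SpR n →* (H ≃ₗᵢ[ℂ] H)) (h : H) : Prop :=
  FiniteDimensional ℂ (Submodule.span ℂ ((fun k => π k h) '' maxCompact n))

/-- The matrix coefficient `c_{h,h'}(g) = ⟨π(g)h, h'⟩` (linear in `h`, conjugate linear
in `h'`; Mathlib's `inner` is conjugate linear in its first argument). -/
def matrixCoeff (π : SpR n →* (H ≃ₗᵢ[ℂ] H)) (h h' : H) (g : SpR n) : ℂ :=
  inner ℂ h' (π g h)

/-- The functional `v* = ⟨·, v⟩` in the dual `H*`. -/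
def dualVec (v : H) : StrongDual ℂ H := InnerProductSpace.toDualMap ℂ H v

/-- The contragredient representation on `H*`, `π*(g)φ = φ ∘ π(g⁻¹)`. -/
def contragredient (π : SpR n →* (H ≃ₗᵢ[ℂ] H)) (g : SpR n) (φ : StrongDual ℂ H) :
    StrongDual ℂ H :=
  φ.comp (π g⁻¹).toContinuousLinearEquiv.toContinuousLinearMap

/-- The inner product `⟨φ, ψ⟩` (linear in `φ`, conjugate linear in `ψ`) of the dual Hilbert
space `H*`, i.e. the one that induces the operator norm, recovered from that norm by polarization. -/
def dualInner (φ ψ : StrongDual ℂ H) : ℂ :=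
  (((‖φ + ψ‖ ^ 2 - ‖φ - ψ‖ ^ 2 : ℝ) : ℂ) +
    Complex.I * ((‖φ + Complex.I • ψ‖ ^ 2 - ‖φ - Complex.I • ψ‖ ^ 2 : ℝ) : ℂ)) / 4

/-- The matrix coefficient `c_{φ,ψ}(g) = ⟨π*(g)φ, ψ⟩` of the contragredient representation. -/
def dualMatrixCoeff (π : SpR n →* (H ≃ₗᵢ[ℂ] H)) (φ ψ : StrongDual ℂ H) (g : SpR n) : ℂ :=
  dualInner (contragredient π g φ) ψ

theorem contragredient_dualVec (π : SpR n →* (H ≃ₗᵢ[ℂ] H)) (g : SpR n) (v : H) :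
    contragredient π g (dualVec v) = dualVec (π g v) := by
  ext x
  simp only [contragredient, dualVec, map_inv, ContinuousLinearMap.comp_apply,
    InnerProductSpace.toDualMap_apply_apply]
  conv_rhs => rw [show x = π g ((π g)⁻¹ x) from ((π g).apply_symm_apply x).symm]
  rw [LinearIsometryEquiv.inner_map_map]
  rfl

theorem dualInner_dualVec (v w : H) : dualInner (dualVec v) (dualVec w) = inner ℂ v w := by
  have e : ∀ c : ℂ, ‖dualVec v + c • dualVec w‖ = ‖v + (starRingEnd ℂ c) • w‖ := by
    intro c
    rw [← (InnerProductSpace.toDualMap ℂ H).norm_map (v + (starRingEnd ℂ c) • w)]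
    rw [map_add, map_smulₛₗ]
    simp [dualVec]
  have e1 := e 1
  have e2 : ‖dualVec v - dualVec w‖ = ‖v - w‖ := by
    have h := e (-1)
    have h' : (-1 : ℂ) • dualVec w = -dualVec w := by
      ext x
      simp
    rw [h'] at h
    simpa [sub_eq_add_neg] using h
  have e3 := e Complex.I
  have e4 : ‖dualVec v - Complex.I • dualVec w‖ = ‖v + Complex.I • w‖ := by
    have h := e (-Complex.I)
    have h' : (-Complex.I) • dualVec w = -(Complex.I • dualVec w) := by
      ext x
      simp
    rw [h'] at h
    simpa [sub_eq_add_neg] using h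
  simp only [one_smul, map_one, neg_smul, Complex.conj_I, ← sub_eq_add_neg] at e1 e3
  rw [dualInner, e1, e2, e3, e4, inner_eq_sum_norm_sq_div_four v w]
  simp
  ring

end Coefficients

end

/-! ### Decompositions of invertible matrices -/

section Decompositions

variable {n : ℕ}

/-! The heart of the matter is a reproducing formula at the base point: `⟨f, f_{1,v}⟩ = C_ρ ⟨f(iI),
v⟩` for every `f` in `H²(ρ)`. Applied to `π_ρ(g)f`, whose value at `iI` is `F_f(g⁻¹)`, it gives (i).
Passing to the dual turns the coefficient in (ii) into `⟨f, π_ρ(g)f_{1,v}⟩ = ⟨π_ρ(g⁻¹)f, f_{1,v}⟩`,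
so (ii) is (i) at `g⁻¹`.

The formula has two halves. The first is a mean value property (`circleAverage_rot`,
`inner_lowestType_eq`). In the Cayley coordinate `w = (z - i)(z + i)⁻¹` the centre of `K` acts by `w
↦ e^{iθ}w`, and `f_{1,v}` is transformed by a scalar unitary matrix applied to `v`. The invariant
integral defining the inner product may therefore be averaged over `θ`. At a fixed `z` the rotated
values of `f`, stripped of that unitary factor, are boundary values of a function of `q` holomorphic
on the closed unit disc, whose value at `q = 0` is `f_{1,f(iI)}(z)`. Hence `f` may be replaced by
`f_{1,f(iI)}`.

The second half is Schur's lemma (`exists_inner_eq_smul_of_unitary_invariant`): `v ↦ f_{1,v}`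
carries the action of `U(n)` to that of `K`, so `⟨f_{1,x}, f_{1,y}⟩` is a constant multiple of `⟨x,
y⟩`, and `x = y = v^{top}` identifies the constant as `C_ρ`. Irreducibility under `U(n)` comes from
polynomiality: a polynomial that vanishes on the compact torus vanishes on the whole torus.

Two analytic facts remain. The isometry of `π_ρ` rests on the invariance of the measure, hence on
the Jacobian of fractional linear maps on symmetric matrices (`det_symConj`,
`IsSymplecticBlocks.lintegral_image`). The membership `f_{1,v} ∈ H²(ρ)` uses the same Jacobian for
the Cayley transform: `y^{1/2}((z + i)/2i)⁻¹` is a contraction, `ρ` is bounded on contractions by a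
multiple of `|det|^{n+1}` since `ω_n ≥ n + 1`, and what is left of the integrand is the Jacobian of
a map onto a bounded domain. -/

theorem posDef_conjTranspose_mul_self_GL (g : GL (Fin n) ℂ) : (g.1ᴴ * g.1).PosDef :=
  PosDef.conjTranspose_mul_self _ (Matrix.mulVec_injective_of_isUnit g.isUnit)

/-- The Cartan decomposition of `GL_n(ℂ)`. -/
theorem exists_unitary_mul_diagonal_mul_unitary (g : GL (Fin n) ℂ) :
    ∃ u₁ d u₂ : GL (Fin n) ℂ, u₁.1 ∈ unitaryGroup (Fin n) ℂ ∧ u₂.1 ∈ unitaryGroup (Fin n) ℂ ∧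
      (∃ t : Fin n → ℂ, d.1 = diagonal t) ∧ g = u₁ * d * u₂ := by
  have hS := posDef_conjTranspose_mul_self_GL g
  set U : Matrix (Fin n) (Fin n) ℂ := (hS.1.eigenvectorUnitary : Matrix (Fin n) (Fin n) ℂ) with hU
  have hUm : U ∈ unitaryGroup (Fin n) ℂ := hS.1.eigenvectorUnitary.2
  have hU1 : Uᴴ * U = 1 := mem_unitaryGroup_iff'.1 hUm
  have hU2 : U * Uᴴ = 1 := mem_unitaryGroup_iff.1 hUm
  -- The singular values of `g`, so that the diagonal factor squares to the spectrum of `gᴴg`.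
  set t : Fin n → ℂ := fun i => (Real.sqrt (hS.1.eigenvalues i) : ℂ) with ht
  have ht0 : ∀ i, t i ≠ 0 := fun i => by
    simpa [ht] using (Real.sqrt_pos.2 (hS.eigenvalues_pos i)).ne'
  have htt : ∀ i, t i * t i = (hS.1.eigenvalues i : ℂ) := fun i => by
    simp only [ht]
    exact_mod_cast congrArg Complex.ofReal (Real.mul_self_sqrt (hS.eigenvalues_pos i).le)
  have hspec : g.1ᴴ * g.1 = U * (diagonal t * diagonal t) * Uᴴ := by
    have h := hS.1.spectral_theorem
    rw [Unitary.conjStarAlgAut_apply] at h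
    rw [diagonal_mul_diagonal]
    simp only [htt]
    exact h
  have hUg : U.det ≠ 0 := fun h => by
    have := congrArg det hU1
    simp [h] at this
  have hdg : (diagonal t).det ≠ 0 := by
    rw [det_diagonal]
    exact Finset.prod_ne_zero_iff.2 fun i _ => ht0 i
  let u : GL (Fin n) ℂ := GeneralLinearGroup.mkOfDetNeZero U hUg
  let d : GL (Fin n) ℂ := GeneralLinearGroup.mkOfDetNeZero (diagonal t) hdg
  have hui : u⁻¹.1 = Uᴴ := by
    have h1 : u⁻¹.1 * U = 1 := congrArg Units.val (inv_mul_cancel u)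
    calc u⁻¹.1 = u⁻¹.1 * (U * Uᴴ) := by rw [hU2, mul_one]
      _ = Uᴴ := by rw [← mul_assoc, h1, one_mul]
  refine ⟨g * u * d⁻¹, d, u⁻¹, ?_, ?_, ⟨t, rfl⟩, by group⟩
  · rw [mem_unitaryGroup_iff', star_eq_conjTranspose]
    have h1 : (g * u * d⁻¹).1 = g.1 * U * d⁻¹.1 := rfl
    have h2 : d.1 * d⁻¹.1 = 1 := congrArg Units.val (mul_inv_cancel d)
    have h3 : d.1ᴴ = d.1 := by
      change (diagonal t)ᴴ = diagonal t
      rw [diagonal_conjTranspose]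
      congr 1
      funext i
      simp [ht]
    have h4 : (d⁻¹.1)ᴴ * d.1 = 1 := by
      have := congrArg conjTranspose h2
      rwa [conjTranspose_mul, conjTranspose_one, h3] at this
    rw [h1, conjTranspose_mul, conjTranspose_mul]
    calc (d⁻¹.1)ᴴ * (Uᴴ * g.1ᴴ) * (g.1 * U * d⁻¹.1)
        = (d⁻¹.1)ᴴ * (Uᴴ * (g.1ᴴ * g.1) * U) * d⁻¹.1 := by simp only [mul_assoc]
      _ = (d⁻¹.1)ᴴ * ((Uᴴ * U) * (d.1 * d.1) * (Uᴴ * U)) * d⁻¹.1 := by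
          rw [hspec]; simp only [mul_assoc]; rfl
      _ = ((d⁻¹.1)ᴴ * d.1) * (d.1 * d⁻¹.1) := by
          rw [hU1, one_mul, mul_one]; simp only [mul_assoc]
      _ = 1 := by rw [h4, h2, mul_one]
  · rw [hui]
    exact Unitary.star_mem hUm

/-- The Iwasawa decomposition of `GL_n(ℂ)`. -/
theorem exists_unitary_mul_upperTriangular (g : GL (Fin n) ℂ) :
    ∃ u b : GL (Fin n) ℂ, u.1 ∈ unitaryGroup (Fin n) ℂ ∧ (∀ r s, s < r → b.1 r s = 0) ∧
      g = u * b := by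
  have hS := posDef_conjTranspose_mul_self_GL g
  have hdiag := LDL.diag_eq_lowerInv_conj hS
  set L := LDL.lowerInv hS with hL
  have hLi : IsUnit L := isUnit_of_invertible L
  have hLinj : Function.Injective (Lᴴ).mulVec :=
    Matrix.mulVec_injective_of_isUnit hLi.star
  have hD : (LDL.diag hS).PosDef := by
    rw [hdiag]
    have := hS.conjTranspose_mul_mul_same hLinj
    rwa [conjTranspose_conjTranspose] at this
  have hpos : ∀ i, 0 < LDL.diagEntries hS i := fun i => by
    have := hD.diag_pos (i := i)
    simpa [LDL.diag] using this
  set t : Fin n → ℂ := fun i => (Real.sqrt (LDL.diagEntries hS i).re : ℂ) with ht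
  have hre : ∀ i, 0 < (LDL.diagEntries hS i).re := fun i => (Complex.pos_iff.1 (hpos i)).1
  have ht0 : ∀ i, t i ≠ 0 := fun i => by
    simpa [ht] using (Real.sqrt_pos.2 (hre i)).ne'
  have htt : ∀ i, t i * t i = LDL.diagEntries hS i := fun i => by
    have h1 : t i * t i = ((LDL.diagEntries hS i).re : ℂ) := by
      simp only [ht]
      exact_mod_cast congrArg Complex.ofReal (Real.mul_self_sqrt (hre i).le)
    rw [h1]
    exact Complex.ext rfl (Complex.pos_iff.1 (hpos i)).2
  have hdg : (diagonal t).det ≠ 0 := by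
    rw [det_diagonal]
    exact Finset.prod_ne_zero_iff.2 fun i _ => ht0 i
  have hLdet : (Lᴴ).det ≠ 0 := by
    rw [det_conjTranspose, star_ne_zero]
    exact ((Matrix.isUnit_iff_isUnit_det _).1 hLi).ne_zero
  let l : GL (Fin n) ℂ := GeneralLinearGroup.mkOfDetNeZero (Lᴴ) hLdet
  let d : GL (Fin n) ℂ := GeneralLinearGroup.mkOfDetNeZero (diagonal t) hdg
  have hltri : (Lᴴ).BlockTriangular (id : Fin n → Fin n) := by
    intro i j hij
    have h : L j i = 0 := LDL.lowerInv_triangular hS hij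
    rw [conjTranspose_apply, h, star_zero]
  have hlinv : (l⁻¹.1).BlockTriangular (id : Fin n → Fin n) := by
    have : Invertible Lᴴ := (hLi.star).invertible
    have h := blockTriangular_inv_of_blockTriangular hltri
    have e : l⁻¹.1 = (Lᴴ)⁻¹ := Matrix.coe_units_inv l
    rwa [e]
  -- Since `L(gᴴg)Lᴴ = D = d²` with `L` lower triangular, the columns of `gLᴴd⁻¹` are orthonormal:
  -- this is Gram–Schmidt applied to `g`.
  refine ⟨g * l * d⁻¹, d * l⁻¹, ?_, ?_, by group⟩
  · rw [mem_unitaryGroup_iff', star_eq_conjTranspose]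
    have h1 : (g * l * d⁻¹).1 = g.1 * Lᴴ * d⁻¹.1 := rfl
    have h2 : d.1 * d⁻¹.1 = 1 := congrArg Units.val (mul_inv_cancel d)
    have h3 : d.1ᴴ = d.1 := by
      change (diagonal t)ᴴ = diagonal t
      rw [diagonal_conjTranspose]
      congr 1
      funext i
      simp [ht]
    have h4 : (d⁻¹.1)ᴴ * d.1 = 1 := by
      have := congrArg conjTranspose h2
      rwa [conjTranspose_mul, conjTranspose_one, h3] at this
    have h5 : d.1 * d.1 = LDL.diag hS := by
      change diagonal t * diagonal t = _
      rw [diagonal_mul_diagonal]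
      simp only [htt]
      rfl
    rw [h1, conjTranspose_mul, conjTranspose_mul, conjTranspose_conjTranspose]
    calc (d⁻¹.1)ᴴ * (L * g.1ᴴ) * (g.1 * Lᴴ * d⁻¹.1)
        = (d⁻¹.1)ᴴ * (L * (g.1ᴴ * g.1) * Lᴴ) * d⁻¹.1 := by simp only [mul_assoc]
      _ = ((d⁻¹.1)ᴴ * d.1) * (d.1 * d⁻¹.1) := by
          rw [← hdiag, ← h5]; simp only [mul_assoc]
      _ = 1 := by rw [h4, h2, mul_one]
  · intro r s hrs
    change (diagonal t * l⁻¹.1) r s = 0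
    rw [diagonal_mul, hlinv hrs, mul_zero]

end Decompositions

/-! ### Polynomial representations which are unitary on `U(n)` -/

section PolynomialReps

variable {n : ℕ} {V : Type*} [NormedAddCommGroup V] [InnerProductSpace ℂ V]
  {ρ : Representation ℂ (GL (Fin n) ℂ) V}

theorem MvPolynomial.differentiable_eval {E σ : Type*} [NormedAddCommGroup E] [NormedSpace ℂ E]
    (P : MvPolynomial σ ℂ) {x : E → σ → ℂ} (hx : ∀ i, Differentiable ℂ fun e => x e i) :
    Differentiable ℂ fun e => MvPolynomial.eval (x e) P := by
  induction P using MvPolynomial.induction_on with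
  | C a => simp
  | add p q hp hq =>
    simp only [map_add]
    exact hp.add hq
  | mul_X p i hp =>
    simp only [map_mul, MvPolynomial.eval_X]
    exact hp.mul (hx i)

theorem IsUnitaryOnUn.norm_map (hunit : IsUnitaryOnUn ρ) {u : GL (Fin n) ℂ}
    (hu : u.1 ∈ unitaryGroup (Fin n) ℂ) (x : V) : ‖ρ u x‖ = ‖x‖ := by
  rw [@norm_eq_sqrt_re_inner ℂ, hunit u hu, ← @norm_eq_sqrt_re_inner ℂ]

/-- The form in which irreducibility is applied: to an eigenspace in Schur's lemma, and to the space
of vectors satisfying a growth bound. -/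
theorem Representation.IsIrreducible.eq_top_of_invariant (hirr : ρ.IsIrreducible)
    {W : Submodule ℂ V} (hW : ∀ g x, x ∈ W → ρ g x ∈ W) {x : V} (hx : x ∈ W) (hx0 : x ≠ 0) :
    W = ⊤ := by
  let W' : Subrepresentation ρ := ⟨W, fun g x h => hW g x h⟩
  rcases hirr.eq_bot_or_eq_top W' with h | h
  · exfalso
    have : x ∈ W' := hx
    rw [h] at this
    exact hx0 ((Submodule.mem_bot ℂ).1 this)
  · exact congrArg Subrepresentation.toSubmodule h

theorem infinite_sphere_zero_one : (Metric.sphere (0 : ℂ) 1).Infinite := by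
  have h : (1 : ℂ) ∈ Metric.sphere (0 : ℂ) 1 := by simp
  have hc : IsPreconnected (Metric.sphere (0 : ℂ) 1) :=
    isPreconnected_sphere (by simp) 0 1
  exact (hc.infinite_of_nontrivial ⟨1, h, -1, by simp, by norm_num⟩)

/-- A subspace stable under `U(n)` is stable under `GL_n(ℂ)`. -/
theorem IsPolynomialRep.invariant_of_unitary_invariant (hpoly : IsPolynomialRep ρ)
    {W : Submodule ℂ V}
    (hW : ∀ u : GL (Fin n) ℂ, u.1 ∈ unitaryGroup (Fin n) ℂ → ∀ x ∈ W, ρ u x ∈ W)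
    (g : GL (Fin n) ℂ) (x : V) (hx : x ∈ W) : ρ g x ∈ W := by
  have key : ∀ (d : GL (Fin n) ℂ) (t : Fin n → ℂ), d.1 = diagonal t → ∀ x ∈ W, ρ d x ∈ W := by
    intro d t hd x hx
    by_contra hn
    obtain ⟨φ, hφ, hφW⟩ := Submodule.exists_le_ker_of_notMem hn
    obtain ⟨P, hP⟩ := hpoly φ x
    -- The restriction of the matrix coefficient `P` to diagonal matrices, as a polynomial in the
    -- diagonal entries.
    let Q : MvPolynomial (Fin n) ℂ :=
      MvPolynomial.bind₁ (fun p : Fin n × Fin n => if p.1 = p.2 then MvPolynomial.X p.1 else 0) P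
    have hQ : ∀ (e : GL (Fin n) ℂ) (s : Fin n → ℂ), e.1 = diagonal s →
        φ (ρ e x) = MvPolynomial.eval s Q := by
      intro e s he
      have h : MvPolynomial.eval s Q = MvPolynomial.eval (fun p => MvPolynomial.eval s
          (if p.1 = p.2 then MvPolynomial.X p.1 else 0)) P :=
        MvPolynomial.eval₂Hom_bind₁ _ _ _ _
      rw [hP, he, h]
      congr 2
      funext p
      by_cases h : p.1 = p.2
      · rw [if_pos h, MvPolynomial.eval_X, h, diagonal_apply_eq]
      · rw [if_neg h, map_zero, diagonal_apply_ne _ h]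
    have hQ0 : Q = 0 := by
      -- Unitary diagonal matrices form a product of infinite sets, which is enough to determine a
      -- polynomial. There `φ` vanishes because `W` is stable under `U(n)`.
      refine MvPolynomial.funext_set (fun _ => Metric.sphere (0 : ℂ) 1)
        (fun _ => infinite_sphere_zero_one) ?_
      intro s hs
      have hs1 : ∀ i, star (s i) * s i = 1 := fun i => by
        have : ‖s i‖ = 1 := by simpa using hs i (Set.mem_univ i)
        rw [← starRingEnd_apply, Complex.conj_mul', this]
        simp
      have hdet : (diagonal s).det ≠ 0 := by
        rw [det_diagonal]
        refine Finset.prod_ne_zero_iff.2 fun i _ h => ?_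
        have := hs1 i
        simp [h] at this
      rw [← hQ (GeneralLinearGroup.mkOfDetNeZero (diagonal s) hdet) s rfl, map_zero]
      refine hφW (hW _ ?_ x hx)
      rw [mem_unitaryGroup_iff', star_eq_conjTranspose]
      change (diagonal s)ᴴ * diagonal s = 1
      rw [diagonal_conjTranspose, diagonal_mul_diagonal, ← diagonal_one]
      congr 1
      funext i
      exact hs1 i
    apply hφ
    rw [hQ d t hd, hQ0, map_zero]
  obtain ⟨u₁, d, u₂, h1, h2, ⟨t, ht⟩, rfl⟩ := exists_unitary_mul_diagonal_mul_unitary g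
  rw [map_mul, map_mul]
  exact hW _ h1 _ (key d t ht _ (hW _ h2 _ hx))

variable [FiniteDimensional ℂ V]

/-- Schur's lemma for the restriction of an irreducible polynomial representation to `U(n)`. -/
theorem exists_inner_eq_smul_of_unitary_invariant (hirr : ρ.IsIrreducible)
    (hpoly : IsPolynomialRep ρ) (hunit : IsUnitaryOnUn ρ)
    {H : Type*} [NormedAddCommGroup H] [InnerProductSpace ℂ H] (L : V →ₗ[ℂ] H)
    (hL : ∀ u : GL (Fin n) ℂ, u.1 ∈ unitaryGroup (Fin n) ℂ →
      ∀ x y, inner ℂ (L (ρ u x)) (L (ρ u y)) = inner ℂ (L x) (L y)) :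
    ∃ c : ℂ, ∀ x y, inner ℂ (L x) (L y) = c * inner ℂ x y := by
  -- `H` need not be complete. Restricting to the finite-dimensional range of `L` makes the adjoint
  -- available, and `T = L*L` represents the pulled-back form.
  let L' := L.rangeRestrict
  let T : V →ₗ[ℂ] V := LinearMap.adjoint L' ∘ₗ L'
  have hT : ∀ x y, inner ℂ x (T y) = inner ℂ (L x) (L y) := fun x y => by
    change inner ℂ x (LinearMap.adjoint L' (L' y)) = _
    rw [LinearMap.adjoint_inner_right]
    rfl
  rcases subsingleton_or_nontrivial V with hV | hV
  · exact ⟨0, fun x y => by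
      rw [Subsingleton.elim x 0, map_zero, inner_zero_left, inner_zero_left, mul_zero]⟩
  obtain ⟨c, hc⟩ := Module.End.exists_eigenvalue T
  obtain ⟨x₀, hx₀⟩ := hc.exists_hasEigenvector
  -- Both forms are `U(n)`-invariant, so `T` commutes with `U(n)` and its eigenspace is stable under
  -- `U(n)`, hence under the whole group.
  have htop : Module.End.eigenspace T c = ⊤ := by
    refine hirr.eq_top_of_invariant (hpoly.invariant_of_unitary_invariant ?_) hx₀.1 hx₀.2
    intro u hu x hx
    rw [Module.End.mem_eigenspace_iff] at hx ⊢
    have hcomm : T (ρ u x) = ρ u (T x) := by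
      refine ext_inner_left ℂ fun y => ?_
      have hy : y = ρ u (ρ u⁻¹ y) := by simp
      rw [hT]
      conv_lhs => rw [hy]
      conv_rhs => rw [hy]
      rw [hL u hu, hunit u hu, hT]
    rw [hcomm, hx, map_smul]
  refine ⟨c, fun x y => ?_⟩
  have hy : y ∈ Module.End.eigenspace T c := by rw [htop]; trivial
  rw [← hT, Module.End.mem_eigenspace_iff.1 hy, inner_smul_right]

end PolynomialReps

/-! ### Holomorphic extension to all matrices, and growth of `ρ` on contractions -/

section HighestWeight

variable {n : ℕ} {V : Type*} [NormedAddCommGroup V] [InnerProductSpace ℂ V]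
  [FiniteDimensional ℂ V] {ρ : Representation ℂ (GL (Fin n) ℂ) V}

open scoped Matrix.Norms.L2Operator

theorem Matrix.differentiable_entry (p : Fin n × Fin n) :
    Differentiable ℂ fun X : Matrix (Fin n) (Fin n) ℂ => X p.1 p.2 :=
  (LinearMap.toContinuousLinearMap (Matrix.entryLinearMap ℂ ℂ p.1 p.2)).differentiable

/-- A polynomial representation extends to a holomorphic function on the space of all matrices. -/
theorem IsPolynomialRep.exists_differentiable (hpoly : IsPolynomialRep ρ) :
    ∃ R : Matrix (Fin n) (Fin n) ℂ → V →L[ℂ] V, Differentiable ℂ R ∧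
      ∀ (g : GL (Fin n) ℂ) (v : V), R g.1 v = ρ g v := by
  let b := Module.finBasis ℂ V
  choose P hP using fun i j => hpoly (b.coord i) (b j)
  refine ⟨fun X => ∑ i, ∑ j, MvPolynomial.eval (fun p => X p.1 p.2) (P i j) •
    (LinearMap.toContinuousLinearMap (b.coord j)).smulRight (b i), ?_, ?_⟩
  · refine Differentiable.fun_sum fun i _ => Differentiable.fun_sum fun j _ => ?_
    exact (MvPolynomial.differentiable_eval _ Matrix.differentiable_entry).smul_const _
  · intro g v
    simp only [_root_.sum_apply, ← hP]
    conv_rhs => rw [← b.sum_repr (ρ g v), ← b.sum_repr v]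
    refine Finset.sum_congr rfl fun i _ => ?_
    rw [map_sum, map_sum, Finsupp.finsetSum_apply, Finset.sum_smul]
    refine Finset.sum_congr rfl fun j _ => ?_
    simp [mul_comm, smul_smul]

/-- The definition only provides some scalar `c` for `b`. Conjugating `b` by diagonal matrices
leaves `c` unchanged and contracts `b` to its diagonal part; continuity of the polynomial extension
then gives `c` as the weight of that diagonal. -/
theorem IsHighestWeightVector.map_upperTriangular (hpoly : IsPolynomialRep ρ) {ω : Fin n → ℤ}
    {v : V} (hv : IsHighestWeightVector ρ ω v) (b : GL (Fin n) ℂ)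
    (hb : ∀ r s, s < r → b.1 r s = 0) : ρ b v = (∏ r, b.1 r r ^ ω r) • v := by
  obtain ⟨R, hR, hRρ⟩ := hpoly.exists_differentiable
  obtain ⟨c, hc⟩ := hv.borel b hb
  -- For `s ≠ 0` this is `d b d⁻¹` with `d = diag(s^{-i})`. Its entries are polynomial in `s`, and
  -- at `s = 0` only the diagonal of `b` survives.
  let B : ℂ → Matrix (Fin n) (Fin n) ℂ := fun s => of fun i j =>
    if i ≤ j then b.1 i j * s ^ (j.1 - i.1) else 0
  have hBc : Continuous B := by
    refine continuous_matrix fun i j => ?_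
    simp only [B, of_apply]
    split_ifs <;> fun_prop
  have h1 : ∀ s : ℂ, s ≠ 0 → R (B s) v = c • v := by
    intro s hs
    let t : Fin n → ℂ := fun i => (s⁻¹) ^ i.1
    have ht : (diagonal t).det ≠ 0 := by
      rw [det_diagonal]
      exact Finset.prod_ne_zero_iff.2 fun i _ => pow_ne_zero _ (inv_ne_zero hs)
    let d : GL (Fin n) ℂ := GeneralLinearGroup.mkOfDetNeZero (diagonal t) ht
    have e : B s * diagonal t = diagonal t * b.1 := by
      ext i j
      rw [mul_diagonal, diagonal_mul]
      simp only [B, of_apply, t]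
      split_ifs with hij
      · have : s⁻¹ ^ j.1 = s⁻¹ ^ (j.1 - i.1) * s⁻¹ ^ i.1 := by
          rw [← pow_add, Nat.sub_add_cancel hij]
        rw [this]
        have h2 : s ^ (j.1 - i.1) * s⁻¹ ^ (j.1 - i.1) = 1 := by
          rw [← mul_pow, mul_inv_cancel₀ hs, one_pow]
        linear_combination (b.1 i j * s⁻¹ ^ i.1) * h2
      · rw [hb i j (not_le.1 hij)]
        simp
    have e2 : B s = (d * b * d⁻¹).1 := by
      have h3 : d.1 * d⁻¹.1 = 1 := congrArg Units.val (mul_inv_cancel d)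
      calc B s = B s * (d.1 * d⁻¹.1) := by rw [h3, mul_one]
        _ = (B s * diagonal t) * d⁻¹.1 := by rw [mul_assoc]; rfl
        _ = _ := by rw [e]; rfl
    have hd := hv.weight d t rfl
    have hp : (∏ r, t r ^ ω r) ≠ 0 :=
      Finset.prod_ne_zero_iff.2 fun i _ => zpow_ne_zero _ (pow_ne_zero _ (inv_ne_zero hs))
    have hdi : ρ d⁻¹ v = (∏ r, t r ^ ω r)⁻¹ • v := by
      have h4 : ρ d⁻¹ (ρ d v) = v := by simp
      rw [hd, map_smul] at h4
      rw [← h4, smul_smul, inv_mul_cancel₀ hp, one_smul, h4]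
    rw [e2, hRρ, map_mul, map_mul, Module.End.mul_apply, Module.End.mul_apply, hdi, map_smul,
      map_smul, hc, map_smul, hd, smul_smul, smul_smul]
    congr 1
    field_simp
  have h2 : Continuous fun s => R (B s) v :=
    (hR.continuous.comp hBc).clm_apply continuous_const
  have h3 : R (B 0) v = c • v := by
    have hcl : IsClosed {s | R (B s) v = c • v} := isClosed_eq h2 continuous_const
    have hd : Dense {s : ℂ | s ≠ 0} := dense_compl_singleton 0
    exact (hcl.closure_subset_iff.2 fun s hs => h1 s hs) (hd 0)
  have h4 : B 0 = diagonal fun i => b.1 i i := by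
    ext i j
    simp only [B, of_apply]
    rcases lt_trichotomy i j with h | h | h
    · rw [if_pos h.le, zero_pow (Nat.sub_ne_zero_of_lt h), mul_zero, diagonal_apply_ne _ h.ne]
    · subst h
      simp
    · rw [if_neg (not_le.2 h), diagonal_apply_ne _ h.ne']
  have hbt : b.1.BlockTriangular id := fun i j h => hb i j h
  have hdet : (diagonal fun i => b.1 i i).det ≠ 0 := by
    rw [det_diagonal, ← det_of_isUpperTriangular hbt]
    exact b.det_ne_zero
  have h5 := hRρ (GeneralLinearGroup.mkOfDetNeZero _ hdet) v
  rw [hv.weight _ (fun i => b.1 i i) rfl] at h5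
  rw [hc, ← h3, h4, ← h5]
  rfl

theorem norm_det_of_mem_unitaryGroup {u : Matrix (Fin n) (Fin n) ℂ}
    (hu : u ∈ unitaryGroup (Fin n) ℂ) : ‖u.det‖ = 1 := by
  have h1 := congrArg det (mem_unitaryGroup_iff'.1 hu)
  rw [det_mul, star_eq_conjTranspose, det_conjTranspose, det_one] at h1
  have h3 := congrArg norm h1
  rw [norm_mul, norm_star, norm_one] at h3
  nlinarith [norm_nonneg u.det]

/-- On contractions, `ρ` is bounded by the power of the determinant given by the lowest entry of
the highest weight. -/
theorem exists_norm_le_of_contraction (hirr : ρ.IsIrreducible) (hpoly : IsPolynomialRep ρ)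
    (hunit : IsUnitaryOnUn ρ) {ω : Fin n → ℤ} {m : ℤ} (hm : ∀ r, m ≤ ω r) {vtop : V}
    (htop : IsHighestWeightVector ρ ω vtop) (v : V) :
    ∃ C : ℝ, 0 ≤ C ∧ ∀ g : GL (Fin n) ℂ, (1 - g.1ᴴ * g.1).PosSemidef →
      ‖ρ g v‖ ≤ C * ‖g.1.det‖ ^ m := by
  -- The vectors satisfying the bound form a subspace, so it suffices that it is stable under `U(n)`
  -- and contains the highest weight vector.
  let W : Submodule ℂ V :=
    { carrier := {v | ∃ C : ℝ, 0 ≤ C ∧ ∀ g : GL (Fin n) ℂ, (1 - g.1ᴴ * g.1).PosSemidef →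
        ‖ρ g v‖ ≤ C * ‖g.1.det‖ ^ m}
      add_mem' := by
        rintro x y ⟨C, hC0, hC⟩ ⟨D, hD0, hD⟩
        refine ⟨C + D, add_nonneg hC0 hD0, fun g hg => ?_⟩
        rw [map_add, add_mul]
        exact (norm_add_le _ _).trans (add_le_add (hC g hg) (hD g hg))
      zero_mem' := ⟨0, le_rfl, fun g _ => by simp⟩
      smul_mem' := by
        rintro c x ⟨C, hC0, hC⟩
        refine ⟨‖c‖ * C, by positivity, fun g hg => ?_⟩
        rw [map_smul, norm_smul, mul_assoc]
        exact mul_le_mul_of_nonneg_left (hC g hg) (norm_nonneg _) }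
  have hWU : ∀ u : GL (Fin n) ℂ, u.1 ∈ unitaryGroup (Fin n) ℂ → ∀ x ∈ W, ρ u x ∈ W := by
    rintro u hu x ⟨C, hC0, hC⟩
    refine ⟨C, hC0, fun g hg => ?_⟩
    have h1 : u.1ᴴ * u.1 = 1 := mem_unitaryGroup_iff'.1 hu
    have h2 := norm_det_of_mem_unitaryGroup hu
    -- Right translation by a unitary matrix preserves both contractions and `|det|`.
    have h3 := hC (g * u) (by
      have := hg.conjTranspose_mul_mul_same u.1
      rw [mul_sub, sub_mul, mul_one, h1] at this
      rw [Units.val_mul, conjTranspose_mul]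
      simpa only [mul_assoc] using this)
    rw [map_mul, Units.val_mul, det_mul, norm_mul, h2, mul_one] at h3
    exact h3
  have hvt : vtop ∈ W := by
    refine ⟨‖vtop‖, norm_nonneg _, fun g hg => ?_⟩
    obtain ⟨u, b, hu, hb, rfl⟩ := exists_unitary_mul_upperTriangular g
    have hbt : b.1.BlockTriangular id := fun i j h => hb i j h
    have h1 : u.1ᴴ * u.1 = 1 := mem_unitaryGroup_iff'.1 hu
    have h2 := norm_det_of_mem_unitaryGroup hu
    have hle : ∀ r, ‖b.1 r r‖ ≤ 1 := fun r => by
      -- The triangular factor is a contraction too, so its columns have norm at most `1`, and a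
      -- fortiori its diagonal entries.
      have h4 : (u * b).1ᴴ * (u * b).1 = b.1ᴴ * b.1 := by
        rw [Units.val_mul, conjTranspose_mul, mul_assoc, ← mul_assoc _ u.1, h1, one_mul]
      rw [h4] at hg
      have h5 := (Complex.nonneg_iff.1 (hg.diag_nonneg (i := r))).1
      have h6 : ((b.1ᴴ * b.1) r r).re = ∑ s, ‖b.1 s r‖ ^ 2 := by
        rw [mul_apply, Complex.re_sum]
        refine Finset.sum_congr rfl fun s _ => ?_
        rw [conjTranspose_apply, ← starRingEnd_apply, Complex.conj_mul']
        norm_cast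
      rw [Matrix.sub_apply, one_apply_eq, Complex.sub_re, h6, Complex.one_re] at h5
      have h7 := Finset.single_le_sum (f := fun s => ‖b.1 s r‖ ^ 2) (fun s _ => by positivity)
        (Finset.mem_univ r)
      nlinarith [norm_nonneg (b.1 r r)]
    have hne : ∀ r, b.1 r r ≠ 0 := by
      have := b.det_ne_zero
      rw [det_of_isUpperTriangular hbt] at this
      exact fun r => Finset.prod_ne_zero_iff.1 this r (Finset.mem_univ r)
    rw [map_mul, Module.End.mul_apply, hunit.norm_map hu, htop.map_upperTriangular hpoly b hb,
      norm_smul, mul_comm, Units.val_mul, det_mul, norm_mul, h2, one_mul,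
      det_of_isUpperTriangular hbt, norm_prod, norm_prod, ← Finset.prod_zpow]
    refine mul_le_mul_of_nonneg_left ?_ (norm_nonneg _)
    refine Finset.prod_le_prod (fun r _ => norm_nonneg _) fun r _ => ?_
    rw [norm_zpow]
    -- As `0 < |b_rr| ≤ 1`, lowering the exponent from `ω_r` to `m` can only increase the power.
    exact zpow_le_zpow_right_of_le_one₀ (norm_pos_iff.2 (hne r)) (hle r) (hm r)
  have hW := hirr.eq_top_of_invariant (hpoly.invariant_of_unitary_invariant hWU) hvt htop.ne_zero
  have : v ∈ W := by rw [hW]; trivial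
  exact this

end HighestWeight

/-! ### The Siegel upper half-space as a topological space -/

section Topology

variable {n : ℕ}

/-- Pulled back through the same coordinates as the measurable structure, so that the latter is the
Borel structure and continuous functions are measurable. -/
noncomputable instance instTopologicalSpaceSiegel (n : ℕ) : TopologicalSpace (SiegelSpace n) :=
  TopologicalSpace.induced siegelCoord inferInstance

instance instBorelSpaceSiegel (n : ℕ) : BorelSpace (SiegelSpace n) where
  measurable_eq := by
    rw [instTopologicalSpaceSiegel, borel_comap, instMeasurableSpaceSiegel,
      BorelSpace.measurable_eq (α := Sym2 (Fin n) → ℂ)]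

instance instSecondCountableTopologySiegel (n : ℕ) : SecondCountableTopology (SiegelSpace n) :=
  TopologicalSpace.secondCountableTopology_induced _ _ siegelCoord

theorem continuous_siegelCoord (n : ℕ) : Continuous (siegelCoord (n := n)) :=
  continuous_induced_dom

theorem SiegelSpace.continuous_val : Continuous fun z : SiegelSpace n => z.1 :=
  continuous_matrix fun r s => (continuous_apply s(r, s)).comp (continuous_siegelCoord n)

theorem SiegelSpace.continuous_of_val {X : Type*} [TopologicalSpace X] {f : X → SiegelSpace n}
    (hf : Continuous fun x => (f x).1) : Continuous f := by
  refine continuous_induced_rng.2 (continuous_pi fun p => ?_)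
  induction p using Sym2.ind with
  | _ r s => exact hf.matrix_elem r s

/-- Needed for Fubini when the inner product is averaged over rotations. -/
instance instSFiniteSiegelMeasure (n : ℕ) : SFinite (siegelMeasure n) := by
  have : SigmaFinite (Measure.comap (siegelCoord (n := n)) volume) := by
    refine SigmaFinite.of_map _ (measurableEmbedding_siegelCoord n).measurable.aemeasurable ?_
    rw [(measurableEmbedding_siegelCoord n).map_comap]
    infer_instance
  unfold siegelMeasure
  infer_instance

variable {V : Type*} [NormedAddCommGroup V] [InnerProductSpace ℂ V]

theorem IsHolomorphic.continuous {f : SiegelSpace n → V} (hf : IsHolomorphic f) :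
    Continuous f := by
  have h := hf.continuousOn.comp_continuous (continuous_siegelCoord n) fun z => ⟨z, rfl⟩
  have e : Function.extend siegelCoord f 0 ∘ siegelCoord = f :=
    funext fun z => (siegelCoord_injective n).extend_apply f 0 z
  exact e ▸ h

theorem continuous_imPart : Continuous (imPart (n := n)) :=
  continuous_matrix fun r s => Complex.continuous_im.comp (continuous_id.matrix_elem r s)

theorem continuous_toC : Continuous (toC (n := n)) :=
  continuous_matrix fun r s => Complex.continuous_ofReal.comp (continuous_id.matrix_elem r s)

open scoped Matrix.Norms.L2Operator in
theorem continuous_sqrtIm : Continuous fun z : SiegelSpace n => (sqrtIm z).1 := by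
  change Continuous fun z : SiegelSpace n => toC (CFC.sqrt (imPart z.1))
  refine continuous_toC.comp ?_
  exact CFC.continuousOn_sqrt.comp_continuous
    (continuous_imPart.comp SiegelSpace.continuous_val) fun z => z.2.2.posSemidef.nonneg

variable [FiniteDimensional ℂ V] {ρ : Representation ℂ (GL (Fin n) ℂ) V}

open scoped Matrix.Norms.L2Operator in
theorem IsPolynomialRep.continuous_apply (hpoly : IsPolynomialRep ρ) {X : Type*}
    [TopologicalSpace X] {g : X → GL (Fin n) ℂ} (hg : Continuous fun x => (g x).1) {f : X → V}
    (hf : Continuous f) : Continuous fun x => ρ (g x) (f x) := by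
  obtain ⟨R, hR, hRρ⟩ := hpoly.exists_differentiable
  simp only [← hRρ]
  exact (hR.continuous.comp hg).clm_apply hf

theorem GL.continuous_inv_val {X : Type*} [TopologicalSpace X] {g : X → GL (Fin n) ℂ}
    (hg : Continuous fun x => (g x).1) : Continuous fun x => ((g x)⁻¹).1 := by
  have e : ∀ x, ((g x)⁻¹).1 = ((g x).1.det)⁻¹ • (g x).1.adjugate := fun x => by
    rw [Matrix.coe_units_inv, Matrix.inv_def, Ring.inverse_eq_inv']
  simp only [e]
  exact (hg.matrix_det.inv₀ fun x => (g x).det_ne_zero).smul hg.matrix_adjugate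

theorem IsPolynomialRep.continuous_weighted (hpoly : IsPolynomialRep ρ) {f : SiegelSpace n → V}
    (hf : Continuous f) : Continuous (weighted ρ f) :=
  hpoly.continuous_apply continuous_sqrtIm hf

end Topology

/-! ### Symmetric matrices and their coordinates -/

section SymmetricMatrices

variable {n : ℕ}

/-- The symmetric matrix with given coordinates. -/
def symMat (n : ℕ) : (Sym2 (Fin n) → ℂ) →ₗ[ℂ] Matrix (Fin n) (Fin n) ℂ where
  toFun c := of fun r s => c s(r, s)
  map_add' _ _ := rfl
  map_smul' _ _ := rfl

/-- The coordinates of the symmetric part of a matrix. -/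
noncomputable def symCoord (n : ℕ) : Matrix (Fin n) (Fin n) ℂ →ₗ[ℂ] (Sym2 (Fin n) → ℂ) where
  toFun M := Sym2.lift ⟨fun r s => (M r s + M s r) / 2, fun r s => by simp only [add_comm]⟩
  map_add' M N := by
    funext p
    induction p using Sym2.ind with
    | _ r s => simp; ring
  map_smul' a M := by
    funext p
    induction p using Sym2.ind with
    | _ r s => simp; ring

theorem symMat_apply (c : Sym2 (Fin n) → ℂ) (r s : Fin n) : symMat n c r s = c s(r, s) := rfl

theorem symCoord_apply (M : Matrix (Fin n) (Fin n) ℂ) (r s : Fin n) :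
    symCoord n M s(r, s) = (M r s + M s r) / 2 := rfl

theorem symMat_isSymm (c : Sym2 (Fin n) → ℂ) : (symMat n c).IsSymm := by
  ext r s
  simp [symMat_apply, Sym2.eq_swap]

theorem symCoord_symMat (c : Sym2 (Fin n) → ℂ) : symCoord n (symMat n c) = c := by
  funext p
  induction p using Sym2.ind with
  | _ r s => rw [symCoord_apply, symMat_apply, symMat_apply, Sym2.eq_swap]; ring

theorem symMat_symCoord {M : Matrix (Fin n) (Fin n) ℂ} (hM : M.IsSymm) :
    symMat n (symCoord n M) = M := by
  ext r s
  rw [symMat_apply, symCoord_apply, hM.apply r s]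
  ring

theorem siegelCoord_eq_symCoord (z : SiegelSpace n) : siegelCoord z = symCoord n z.1 := by
  funext p
  induction p using Sym2.ind with
  | _ r s =>
    rw [symCoord_apply, z.2.1.apply r s]
    change z.1 r s = _
    ring

theorem symMat_siegelCoord (z : SiegelSpace n) : symMat n (siegelCoord z) = z.1 := rfl

/-- The endomorphism `h ↦ Pᵀ h P` of the space of symmetric matrices, in coordinates. -/
noncomputable def symConj (P : Matrix (Fin n) (Fin n) ℂ) :
    (Sym2 (Fin n) → ℂ) →ₗ[ℂ] (Sym2 (Fin n) → ℂ) :=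
  symCoord n ∘ₗ (LinearMap.mulLeft ℂ Pᵀ ∘ₗ LinearMap.mulRight ℂ P) ∘ₗ symMat n

theorem symConj_apply (P : Matrix (Fin n) (Fin n) ℂ) (h : Sym2 (Fin n) → ℂ) :
    symConj P h = symCoord n (Pᵀ * (symMat n h * P)) := rfl

theorem symConj_mul (P Q : Matrix (Fin n) (Fin n) ℂ) :
    symConj (P * Q) = symConj Q ∘ₗ symConj P := by
  refine LinearMap.ext fun h => ?_
  have hs : (Pᵀ * (symMat n h * P)).IsSymm := by
    rw [IsSymm, transpose_mul, transpose_mul, transpose_transpose, (symMat_isSymm h).eq, mul_assoc]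
  rw [LinearMap.comp_apply, symConj_apply, symConj_apply Q, symConj_apply P, symMat_symCoord hs,
    transpose_mul]
  simp only [mul_assoc]

theorem det_symConj_mul (P Q : Matrix (Fin n) (Fin n) ℂ) :
    LinearMap.det (symConj (P * Q)) = LinearMap.det (symConj P) * LinearMap.det (symConj Q) := by
  rw [symConj_mul, LinearMap.det_comp, mul_comm]

theorem det_symConj_one : LinearMap.det (symConj (1 : Matrix (Fin n) (Fin n) ℂ)) = 1 := by
  have : symConj (1 : Matrix (Fin n) (Fin n) ℂ) = LinearMap.id := by
    refine LinearMap.ext fun h => ?_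
    simp [symConj_apply, symCoord_symMat]
  rw [this, LinearMap.det_id]

/-- The factor `t_r` appears twice in the pair `{r, r}` and once in each of the `n - 1` pairs `{r,
s}` with `s ≠ r`, hence `n + 1` times in all. -/
theorem prod_sym2_mul_eq_pow (t : Fin n → ℂ) :
    ∏ p : Sym2 (Fin n), Sym2.lift ⟨fun r s => t r * t s, fun _ _ => mul_comm _ _⟩ p =
      (∏ r, t r) ^ (n + 1) := by
  set τ : Sym2 (Fin n) → ℂ := Sym2.lift ⟨fun r s => t r * t s, fun _ _ => mul_comm _ _⟩
  have hτ : ∀ r s, τ s(r, s) = t r * t s := fun _ _ => rfl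
  rw [← Finset.prod_filter_mul_prod_filter_not Finset.univ (fun p : Sym2 (Fin n) => p.IsDiag)]
  have h1 : ∏ p : Sym2 (Fin n) with p.IsDiag, τ p = ∏ r, t r * t r := by
    symm
    refine Finset.prod_bij (fun r _ => s(r, r)) (by simp) (by simp) ?_ (by simp [hτ])
    intro p hp
    induction p using Sym2.ind with
    | _ r s =>
      have : r = s := by simpa using hp
      exact ⟨r, Finset.mem_univ _, by rw [this]⟩
  have h2 : ∏ p : Sym2 (Fin n) with ¬ p.IsDiag, τ p =
      ∏ q : Fin n × Fin n with q.1 < q.2, t q.1 * t q.2 := by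
    symm
    refine Finset.prod_bij (fun q _ => s(q.1, q.2)) ?_ ?_ ?_ (by simp [hτ])
    · intro q hq
      simpa using (Finset.mem_filter.1 hq).2.ne
    · rintro ⟨a, b⟩ ha ⟨c, d⟩ hc h
      simp only [Finset.mem_filter, Finset.mem_univ, true_and] at ha hc
      rcases Sym2.eq_iff.1 h with ⟨rfl, rfl⟩ | ⟨rfl, rfl⟩
      · rfl
      · exact absurd ha hc.asymm
    · intro p hp
      induction p using Sym2.ind with
      | _ r s =>
        have : r ≠ s := by simpa using hp
        rcases lt_or_gt_of_ne this with h | h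
        · exact ⟨(r, s), by simpa using h, rfl⟩
        · exact ⟨(s, r), by simpa using h, Sym2.eq_swap⟩
  have h3 : ∏ q : Fin n × Fin n with q.1 < q.2, t q.2 =
      ∏ q : Fin n × Fin n with q.2 < q.1, t q.1 :=
    Finset.prod_bij (fun q _ => q.swap) (by simp) (by simp) (fun q hq => ⟨q.swap, by simpa using hq,
      by simp⟩) (by simp)
  have h4 : (∏ r, t r) ^ n = (∏ q : Fin n × Fin n with q.1 < q.2, t q.1) *
      (∏ q : Fin n × Fin n with q.2 < q.1, t q.1) * ∏ r, t r := by
    have e1 : (∏ r, t r) ^ n = ∏ q : Fin n × Fin n, t q.1 := by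
      rw [Fintype.prod_prod_type, ← Finset.prod_pow]
      simp
    have e2 : (∏ q : Fin n × Fin n with q.2 < q.1, t q.1) * ∏ r, t r =
        ∏ q : Fin n × Fin n with ¬ q.1 < q.2, t q.1 := by
      rw [← Finset.prod_filter_mul_prod_filter_not
        (Finset.univ.filter fun q : Fin n × Fin n => ¬ q.1 < q.2) (fun q => q.2 < q.1),
        Finset.filter_filter, Finset.filter_filter]
      congr 1
      · refine Finset.prod_congr (Finset.filter_congr fun q _ => ?_) fun _ _ => rfl
        exact ⟨fun h => ⟨h.asymm, h⟩, fun h => h.2⟩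
      · refine Finset.prod_bij (fun r _ => (r, r)) (by simp) (by simp) ?_ (by simp)
        rintro ⟨a, b⟩ hq
        simp only [Finset.mem_filter, Finset.mem_univ, true_and, not_lt] at hq
        exact ⟨a, Finset.mem_univ _, by rw [le_antisymm hq.1 hq.2]⟩
    rw [e1, mul_assoc, e2, Finset.prod_filter_mul_prod_filter_not]
  rw [h1, h2, Finset.prod_mul_distrib, Finset.prod_mul_distrib, h3, pow_succ, h4]
  ring

theorem det_symConj_diagonal (t : Fin n → ℂ) :
    LinearMap.det (symConj (diagonal t)) = (diagonal t).det ^ (n + 1) := by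
  have h : symConj (diagonal t) = Matrix.toLin' (diagonal
      (Sym2.lift ⟨fun r s => t r * t s, fun _ _ => mul_comm _ _⟩)) := by
    refine LinearMap.ext fun h => ?_
    funext p
    induction p using Sym2.ind with
    | _ r s =>
      rw [symConj_apply, symCoord_apply, toLin'_apply, mulVec_diagonal, diagonal_transpose,
        diagonal_mul, mul_diagonal, diagonal_mul, mul_diagonal, symMat_apply, symMat_apply,
        Sym2.lift_mk, Sym2.eq_swap (a := s)]
      ring
  rw [h, LinearMap.det_toLin', det_diagonal, det_diagonal, prod_sym2_mul_eq_pow]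

/-- The left side is multiplicative in `P`, so diagonal matrices and transvections suffice. The
former act diagonally with eigenvalues `t_r t_s`; the latter must act with determinant `1`. -/
theorem det_symConj {P : Matrix (Fin n) (Fin n) ℂ} (hP : P.det ≠ 0) :
    LinearMap.det (symConj P) = P.det ^ (n + 1) := by
  refine diagonal_transvection_induction_of_det_ne_zero
    (fun P => LinearMap.det (symConj P) = P.det ^ (n + 1)) P hP
    (fun D _ => det_symConj_diagonal D) ?_ ?_
  · rintro ⟨i, j, hij, c⟩
    rw [TransvectionStruct.det, one_pow]
    change LinearMap.det (symConj (transvection i j c)) = 1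
    set x := LinearMap.det (symConj (transvection i j c)) with hx
    -- Conjugation by this diagonal matrix doubles the parameter, turning the transvection into its
    -- own square. Hence `x = x²`, and `x ≠ 0` forces `x = 1`.
    let t : Fin n → ℂ := fun k => if k = i then 2 else 1
    have ht : ∀ k, t k ≠ 0 := fun k => by
      simp only [t]
      split_ifs <;> norm_num
    have h1 : diagonal t * transvection i j c =
        (transvection i j c * transvection i j c) * diagonal t := by
      rw [transvection_mul_transvection_same _ _ hij]
      ext a b
      rw [diagonal_mul, mul_diagonal, transvection, transvection, Matrix.add_apply,
        Matrix.add_apply, Matrix.single_apply, Matrix.single_apply, one_apply]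
      simp only [t]
      by_cases ha : i = a
      · subst ha
        by_cases hb : j = b
        · subst hb
          simp [hij, hij.symm]
          ring
        · by_cases hab : i = b
          · subst hab
            simp [hb]
          · simp [hab, hb]
      · by_cases hab : a = b
        · subst hab
          simp [ha]
        · simp [ha, hab]
    have h2 := congrArg (fun M => LinearMap.det (symConj M)) h1
    simp only [det_symConj_mul, det_symConj_diagonal, ← hx] at h2
    have hd : (diagonal t).det ^ (n + 1) ≠ 0 := by
      rw [det_diagonal]
      exact pow_ne_zero _ (Finset.prod_ne_zero_iff.2 fun k _ => ht k)
    have hx0 : x ≠ 0 := by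
      intro h0
      have h3 : transvection i j c * transvection i j (-c) = 1 := by
        rw [transvection_mul_transvection_same _ _ hij, add_neg_cancel, transvection_zero]
      have h4 := congrArg (fun M => LinearMap.det (symConj M)) h3
      simp only [det_symConj_mul, ← hx, h0, zero_mul, det_symConj_one] at h4
      exact zero_ne_one h4
    have h5 : x * (x - 1) = 0 := by
      refine (mul_eq_zero.1 ?_).resolve_left hd
      linear_combination -h2
    exact sub_eq_zero.1 ((mul_eq_zero.1 h5).resolve_left hx0)
  · intro A B _ _ hA hB
    rw [det_symConj_mul, hA, hB, det_mul, mul_pow]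

end SymmetricMatrices

/-! ### Complex fractional linear transformations of symmetric matrices -/

section FractionalLinear

variable {n : ℕ}

/-- The blocks of a complex symplectic matrix. -/
structure IsSymplecticBlocks (A B C D : Matrix (Fin n) (Fin n) ℂ) : Prop where
  left : Aᵀ * C = Cᵀ * A
  right : Bᵀ * D = Dᵀ * B
  cross : Aᵀ * D - Cᵀ * B = 1

variable {A B C D : Matrix (Fin n) (Fin n) ℂ}

/-- Polarized symplectic relation. With `w = z` it yields the symmetry of the image, and with two
points of equal image it yields injectivity. -/
theorem IsSymplecticBlocks.sub_eq (h : IsSymplecticBlocks A B C D)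
    {z w : Matrix (Fin n) (Fin n) ℂ} (hz : z.IsSymm) :
    (C * z + D)ᵀ * (A * w + B) - (A * z + B)ᵀ * (C * w + D) = w - z := by
  obtain ⟨h1, h2, h3⟩ := h
  have h4 := congrArg transpose h3
  simp only [transpose_sub, transpose_mul, transpose_transpose, transpose_one] at h4
  simp only [transpose_add, transpose_mul, hz.eq]
  have e : (z * Cᵀ + Dᵀ) * (A * w + B) - (z * Aᵀ + Bᵀ) * (C * w + D) =
      (Dᵀ * A - Bᵀ * C) * w - z * (Aᵀ * D - Cᵀ * B) - z * (Aᵀ * C - Cᵀ * A) * w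
        - (Bᵀ * D - Dᵀ * B) := by noncomm_ring
  rw [e, h3, h4, h1, h2]
  simp

theorem IsSymplecticBlocks.isSymm (h : IsSymplecticBlocks A B C D)
    {z : Matrix (Fin n) (Fin n) ℂ} (hz : z.IsSymm) (hdet : (C * z + D).det ≠ 0) :
    ((A * z + B) * (C * z + D)⁻¹).IsSymm := by
  have e1 := sub_eq_zero.1 ((h.sub_eq (w := z) hz).trans (sub_self z))
  have hN := Matrix.mul_nonsing_inv _ (isUnit_iff_ne_zero.2 hdet)
  generalize C * z + D = N at *
  generalize A * z + B = M at *
  have hNT : (N⁻¹)ᵀ * Nᵀ = 1 := by rw [← transpose_mul, hN, transpose_one]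
  have a : (N⁻¹)ᵀ * (Nᵀ * M) * N⁻¹ = (N⁻¹)ᵀ * (Mᵀ * N) * N⁻¹ := by rw [e1]
  rw [← mul_assoc, hNT, one_mul, mul_assoc, mul_assoc, hN, mul_one] at a
  rw [Matrix.IsSymm, transpose_mul]
  exact a.symm

theorem IsSymplecticBlocks.injective (h : IsSymplecticBlocks A B C D)
    {z w : Matrix (Fin n) (Fin n) ℂ} (hz : z.IsSymm) (hzd : (C * z + D).det ≠ 0)
    (hwd : (C * w + D).det ≠ 0)
    (e : (A * z + B) * (C * z + D)⁻¹ = (A * w + B) * (C * w + D)⁻¹) : z = w := by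
  have hs := h.isSymm hz hzd
  have hN := Matrix.nonsing_inv_mul _ (isUnit_iff_ne_zero.2 hzd)
  have hN' := Matrix.nonsing_inv_mul _ (isUnit_iff_ne_zero.2 hwd)
  have e1 : A * z + B = ((A * z + B) * (C * z + D)⁻¹) * (C * z + D) := by
    rw [mul_assoc, hN, mul_one]
  have e2 : A * w + B = ((A * z + B) * (C * z + D)⁻¹) * (C * w + D) := by
    rw [e, mul_assoc, hN', mul_one]
  have e3 := h.sub_eq (w := w) hz
  generalize (A * z + B) * (C * z + D)⁻¹ = q at *
  rw [e1, e2, transpose_mul, hs.eq, mul_assoc, sub_self] at e3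
  exact (sub_eq_zero.1 e3.symm).symm

open scoped Matrix.Norms.L2Operator in
theorem HasFDerivAt.matrix_inv {E : Type*} [NormedAddCommGroup E] [NormedSpace ℂ E]
    {F : E → Matrix (Fin n) (Fin n) ℂ} {F' : E →L[ℂ] Matrix (Fin n) (Fin n) ℂ} {x : E}
    (hF : HasFDerivAt F F' x) (hdet : (F x).det ≠ 0) :
    HasFDerivAt (fun e => (F e)⁻¹)
      ((-(ContinuousLinearMap.mulLeftRight ℂ (Matrix (Fin n) (Fin n) ℂ) (F x)⁻¹ (F x)⁻¹)).comp F')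
      x := by
  let u : GL (Fin n) ℂ := GeneralLinearGroup.mkOfDetNeZero (F x) hdet
  have h : HasFDerivAt (Ring.inverse : Matrix (Fin n) (Fin n) ℂ → _) _ (F x) :=
    hasFDerivAt_ringInverse (𝕜 := ℂ) u
  have hu : (u⁻¹).1 = (F x)⁻¹ := Matrix.coe_units_inv u
  rw [hu] at h
  have h2 := h.comp x hF
  have e : (fun e => (F e)⁻¹) = Ring.inverse ∘ F :=
    funext fun e => Matrix.nonsing_inv_eq_ringInverse _
  rw [e]
  exact h2

open scoped Matrix.Norms.L2Operator in
/-- The derivative of a fractional linear transformation, in coordinates. -/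
theorem IsSymplecticBlocks.hasFDerivAt (h : IsSymplecticBlocks A B C D)
    (c : Sym2 (Fin n) → ℂ) (hdet : (C * symMat n c + D).det ≠ 0) :
    HasFDerivAt (fun c => symCoord n ((A * symMat n c + B) * (C * symMat n c + D)⁻¹))
      (LinearMap.toContinuousLinearMap (symConj (C * symMat n c + D)⁻¹)) c := by
  let S := LinearMap.toContinuousLinearMap (symMat n)
  let κ := LinearMap.toContinuousLinearMap (symCoord n)
  have hlin : ∀ X Y : Matrix (Fin n) (Fin n) ℂ, HasFDerivAt (fun c => X * symMat n c + Y)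
      ((ContinuousLinearMap.mul ℂ _ X).comp S) c := fun X Y =>
    ((((ContinuousLinearMap.mul ℂ _ X).comp S).hasFDerivAt (x := c)).add_const Y)
  have hinv := (hlin C D).matrix_inv hdet
  have hprod := κ.hasFDerivAt.comp c ((hlin A B).mul' hinv)
  refine hprod.congr_fderiv ?_
  have hs := h.isSymm (symMat_isSymm c) hdet
  have hN := Matrix.mul_nonsing_inv _ (isUnit_iff_ne_zero.2 hdet)
  have hNi := Matrix.nonsing_inv_mul _ (isUnit_iff_ne_zero.2 hdet)
  -- With `M = Az + B` and `N = Cz + D`, the product rule gives the derivative `h ↦ (A - M N⁻¹ C) h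
  -- N⁻¹`. Symmetry of `M N⁻¹` and the symplectic relations turn the left factor into the transpose
  -- of `N⁻¹`.
  have key : A - (A * symMat n c + B) * (C * symMat n c + D)⁻¹ * C =
      ((C * symMat n c + D)⁻¹)ᵀ := by
    have h4 := congrArg transpose h.cross
    simp only [transpose_sub, transpose_mul, transpose_transpose, transpose_one] at h4
    have e : (C * symMat n c + D)ᵀ * A - (A * symMat n c + B)ᵀ * C = 1 := by
      simp only [transpose_add, transpose_mul, (symMat_isSymm c).eq]
      have e : (symMat n c * Cᵀ + Dᵀ) * A - (symMat n c * Aᵀ + Bᵀ) * C =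
        (Dᵀ * A - Bᵀ * C) - symMat n c * (Aᵀ * C - Cᵀ * A) := by noncomm_ring
      rw [e, h4, h.left]
      simp
    generalize C * symMat n c + D = N at *
    generalize A * symMat n c + B = M at *
    have hNT : (N⁻¹)ᵀ * Nᵀ = 1 := by rw [← transpose_mul, hN, transpose_one]
    have h5 : M * N⁻¹ = (N⁻¹)ᵀ * Mᵀ := by rw [← transpose_mul, hs.eq]
    calc A - M * N⁻¹ * C = (N⁻¹)ᵀ * (Nᵀ * A - Mᵀ * C) := by
          rw [h5, mul_sub, ← mul_assoc, hNT, one_mul, mul_assoc]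
      _ = (N⁻¹)ᵀ := by rw [e, mul_one]
  refine ContinuousLinearMap.ext fun x => ?_
  change symCoord n ((A * symMat n c + B) * (-((C * symMat n c + D)⁻¹ * (C * symMat n x) *
    (C * symMat n c + D)⁻¹)) + A * symMat n x * (C * symMat n c + D)⁻¹) =
    symCoord n (((C * symMat n c + D)⁻¹)ᵀ * (symMat n x * (C * symMat n c + D)⁻¹))
  rw [← key]
  congr 1
  noncomm_ring

/-- The real determinant of a complex linear map is the squared modulus of its complex determinant.
-/
theorem abs_det_restrictScalars_symConj {P : Matrix (Fin n) (Fin n) ℂ} (hP : P.det ≠ 0) :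
    |((LinearMap.toContinuousLinearMap (symConj P⁻¹)).restrictScalars ℝ).det| =
      (‖P.det‖ ^ 2) ^ (-((n : ℤ) + 1)) := by
  have h1 : ((LinearMap.toContinuousLinearMap (symConj P⁻¹)).restrictScalars ℝ).det =
      LinearMap.det ((symConj P⁻¹).restrictScalars ℝ) := rfl
  have hPi : (P⁻¹).det ≠ 0 := by
    rw [det_nonsing_inv, Ring.inverse_eq_inv']
    exact inv_ne_zero hP
  rw [h1, LinearMap.det_restrictScalars, det_symConj hPi, Algebra.norm_complex_eq,
    det_nonsing_inv, Ring.inverse_eq_inv']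
  change |Complex.normSq _| = _
  rw [Complex.normSq_eq_norm_sq, abs_of_nonneg (by positivity), norm_pow, norm_inv,
    _root_.zpow_neg, ← pow_mul, inv_pow, ← Nat.cast_succ, zpow_natCast, ← pow_mul, mul_comm]

/-- Lebesgue measure in the coordinates of the Siegel upper half-space. -/
noncomputable abbrev siegelLebesgue (n : ℕ) : Measure (SiegelSpace n) :=
  Measure.comap siegelCoord volume

theorem lintegral_siegelLebesgue (G : (Sym2 (Fin n) → ℂ) → ENNReal) :
    ∫⁻ z, G (siegelCoord z) ∂(siegelLebesgue n) =
      ∫⁻ c in Set.range (siegelCoord (n := n)), G c := by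
  rw [← (measurableEmbedding_siegelCoord n).map_comap,
    (measurableEmbedding_siegelCoord n).lintegral_map]

/-- The change of variables formula for fractional linear transformations. -/
theorem IsSymplecticBlocks.lintegral_image (h : IsSymplecticBlocks A B C D)
    (hdet : ∀ z : SiegelSpace n, (C * z.1 + D).det ≠ 0)
    (G : (Sym2 (Fin n) → ℂ) → ENNReal) :
    ∫⁻ c in (fun c => symCoord n ((A * symMat n c + B) * (C * symMat n c + D)⁻¹)) ''
        Set.range (siegelCoord (n := n)), G c =
      ∫⁻ z : SiegelSpace n, ENNReal.ofReal ((‖(C * z.1 + D).det‖ ^ 2) ^ (-((n : ℤ) + 1))) *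
        G (symCoord n ((A * z.1 + B) * (C * z.1 + D)⁻¹)) ∂(siegelLebesgue n) := by
  have hdet' : ∀ c ∈ Set.range (siegelCoord (n := n)), (C * symMat n c + D).det ≠ 0 := by
    rintro _ ⟨z, rfl⟩
    exact hdet z
  rw [lintegral_image_eq_lintegral_abs_det_fderiv_mul volume
    (isOpen_range_siegelCoord n).measurableSet
    (fun c hc => ((h.hasFDerivAt c (hdet' c hc)).restrictScalars ℝ).hasFDerivWithinAt) ?_ G]
  · rw [← lintegral_siegelLebesgue]
    refine lintegral_congr fun z => ?_
    simp only [symMat_siegelCoord]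
    rw [abs_det_restrictScalars_symConj (hdet z)]
  · rintro c hc d hd e
    -- Injectivity holds on matrices. Returning from coordinates loses nothing because both images
    -- are symmetric.
    have e' := congrArg (symMat n) e
    simp only at e'
    rw [symMat_symCoord (h.isSymm (symMat_isSymm c) (hdet' c hc)),
      symMat_symCoord (h.isSymm (symMat_isSymm d) (hdet' d hd))] at e'
    have e2 := h.injective (symMat_isSymm c) (hdet' c hc) (hdet' d hd) e'
    rw [← symCoord_symMat c, e2, symCoord_symMat]

end FractionalLinear

/-! ### The action of the symplectic group -/

section Action

variable {n : ℕ}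

theorem toC_mul (X Y : Matrix (Fin n) (Fin n) ℝ) : toC (X * Y) = toC X * toC Y :=
  Matrix.map_mul

theorem toC_add (X Y : Matrix (Fin n) (Fin n) ℝ) : toC (X + Y) = toC X + toC Y :=
  Matrix.map_add _ (map_add _) _ _

theorem toC_one : toC (1 : Matrix (Fin n) (Fin n) ℝ) = 1 := by
  simp [toC]

theorem toC_zero : toC (0 : Matrix (Fin n) (Fin n) ℝ) = 0 := by
  simp [toC]

theorem det_toC (X : Matrix (Fin n) (Fin n) ℝ) : (toC X).det = (X.det : ℂ) := by
  rw [toC, ← RingHom.mapMatrix_apply, ← RingHom.map_det]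
  rfl

theorem SpR.isSymplecticBlocks (g : SpR n) :
    IsSymplecticBlocks (toC g.1.toBlocks₁₁) (toC g.1.toBlocks₁₂) (toC g.1.toBlocks₂₁)
      (toC g.1.toBlocks₂₂) :=
  ⟨(sp_block_relations g).1, (sp_block_relations g).2.1, (sp_block_relations g).2.2⟩

theorem toC_blocks_mul (g h : SpR n) :
    toC (g * h).1.toBlocks₁₁ =
      toC g.1.toBlocks₁₁ * toC h.1.toBlocks₁₁ + toC g.1.toBlocks₁₂ * toC h.1.toBlocks₂₁ ∧
    toC (g * h).1.toBlocks₁₂ =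
      toC g.1.toBlocks₁₁ * toC h.1.toBlocks₁₂ + toC g.1.toBlocks₁₂ * toC h.1.toBlocks₂₂ ∧
    toC (g * h).1.toBlocks₂₁ =
      toC g.1.toBlocks₂₁ * toC h.1.toBlocks₁₁ + toC g.1.toBlocks₂₂ * toC h.1.toBlocks₂₁ ∧
    toC (g * h).1.toBlocks₂₂ =
      toC g.1.toBlocks₂₁ * toC h.1.toBlocks₁₂ + toC g.1.toBlocks₂₂ * toC h.1.toBlocks₂₂ := by
  have e : (g * h).1 = g.1 * h.1 := rfl
  have e2 := fromBlocks_multiply g.1.toBlocks₁₁ g.1.toBlocks₁₂ g.1.toBlocks₂₁ g.1.toBlocks₂₂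
    h.1.toBlocks₁₁ h.1.toBlocks₁₂ h.1.toBlocks₂₁ h.1.toBlocks₂₂
  rw [fromBlocks_toBlocks, fromBlocks_toBlocks, ← e] at e2
  simp only [← toC_mul, ← toC_add]
  rw [e2]
  exact ⟨rfl, rfl, rfl, rfl⟩

theorem spAct_val_mul_spDen (g : SpR n) (z : SiegelSpace n) :
    (spAct g z).1 * spDen g z.1 = spNum g z.1 := by
  change spNum g z.1 * (spDen g z.1)⁻¹ * spDen g z.1 = _
  rw [mul_assoc, Matrix.nonsing_inv_mul _ (isUnit_iff_ne_zero.2 (det_spDen_ne_zero g z)), mul_one]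

theorem spDen_mul (g h : SpR n) (z : SiegelSpace n) :
    spDen (g * h) z.1 = spDen g (spAct h z).1 * spDen h z.1 := by
  obtain ⟨-, -, h3, h4⟩ := toC_blocks_mul g h
  have e := spAct_val_mul_spDen h z
  rw [spDen.eq_def g, add_mul, mul_assoc, e, spDen, spDen, spNum, h3, h4]
  noncomm_ring

theorem spNum_mul (g h : SpR n) (z : SiegelSpace n) :
    spNum (g * h) z.1 = spNum g (spAct h z).1 * spDen h z.1 := by
  obtain ⟨h1, h2, -, -⟩ := toC_blocks_mul g h
  have e := spAct_val_mul_spDen h z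
  rw [spNum.eq_def g, add_mul, mul_assoc, e, spNum, spDen, spNum, h1, h2]
  noncomm_ring

theorem spFactor_mul (g h : SpR n) (z : SiegelSpace n) :
    spFactor (g * h) z = spFactor g (spAct h z) * spFactor h z :=
  Units.ext (spDen_mul g h z)

theorem spAct_mul (g h : SpR n) (z : SiegelSpace n) :
    spAct (g * h) z = spAct g (spAct h z) := by
  apply Subtype.ext
  change spNum (g * h) z.1 * (spDen (g * h) z.1)⁻¹ =
    spNum g (spAct h z).1 * (spDen g (spAct h z).1)⁻¹
  rw [spNum_mul, spDen_mul, Matrix.mul_inv_rev, mul_assoc, ← mul_assoc _ _ (spDen g _)⁻¹,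
    Matrix.mul_nonsing_inv _ (isUnit_iff_ne_zero.2 (det_spDen_ne_zero h z)), one_mul]

theorem spDen_one (z : Matrix (Fin n) (Fin n) ℂ) : spDen (1 : SpR n) z = 1 := by
  have e : (1 : SpR n).1 = fromBlocks 1 0 0 1 := fromBlocks_one.symm
  rw [spDen, e, toBlocks_fromBlocks₂₁, toBlocks_fromBlocks₂₂, toC_one, toC_zero, zero_mul, zero_add]

theorem spNum_one (z : Matrix (Fin n) (Fin n) ℂ) : spNum (1 : SpR n) z = z := by
  have e : (1 : SpR n).1 = fromBlocks 1 0 0 1 := fromBlocks_one.symm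
  rw [spNum, e, toBlocks_fromBlocks₁₁, toBlocks_fromBlocks₁₂, toC_one, toC_zero, one_mul, add_zero]

theorem spFactor_one (z : SiegelSpace n) : spFactor (1 : SpR n) z = 1 :=
  Units.ext (spDen_one z.1)

theorem spAct_one (z : SiegelSpace n) : spAct (1 : SpR n) z = z := by
  apply Subtype.ext
  change spNum (1 : SpR n) z.1 * (spDen (1 : SpR n) z.1)⁻¹ = z.1
  rw [spNum_one, spDen_one, inv_one, mul_one]

/-- The transformation law of the imaginary part. Its determinant makes the measure invariant, and
the matrix identity itself makes `‖ρ(y^{1/2})f‖` equivariant. -/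
theorem spDen_conjTranspose_mul_imPart (g : SpR n) (z : SiegelSpace n) :
    (spDen g z.1)ᴴ * toC (imPart (spAct g z).1) * spDen g z.1 = toC (imPart z.1) := by
  have e1 := sp_herm_relation g (z := z.1)
  rw [← spAct_val_mul_spDen, sub_conjTranspose_of_isSymm z.2.1] at e1
  have e2 := sub_conjTranspose_of_isSymm (spAct g z).2.1
  apply smul_right_injective _ (show (2 * Complex.I) ≠ 0 by simp)
  change (2 * Complex.I) • _ = (2 * Complex.I) • _
  rw [← e1, ← Matrix.smul_mul, ← Matrix.mul_smul, ← e2, conjTranspose_mul]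
  noncomm_ring

theorem det_imPart_spAct (g : SpR n) (z : SiegelSpace n) :
    ‖(spDen g z.1).det‖ ^ 2 * (imPart (spAct g z).1).det = (imPart z.1).det := by
  have h := congrArg det (spDen_conjTranspose_mul_imPart g z)
  rw [det_mul, det_mul, det_conjTranspose, det_toC, det_toC, mul_right_comm, ← starRingEnd_apply,
    Complex.conj_mul'] at h
  exact_mod_cast h

theorem continuous_spAct (g : SpR n) : Continuous (spAct (n := n) g) := by
  refine SiegelSpace.continuous_of_val ?_
  have h1 : Continuous fun z : SiegelSpace n => spNum g z.1 :=
    (continuous_const.matrix_mul SiegelSpace.continuous_val).add continuous_const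
  have h2 : Continuous fun z : SiegelSpace n => spDen g z.1 :=
    (continuous_const.matrix_mul SiegelSpace.continuous_val).add continuous_const
  have h3 : Continuous fun z : SiegelSpace n => ((spFactor g z)⁻¹).1 :=
    GL.continuous_inv_val h2
  have e : ∀ z : SiegelSpace n, (spAct g z).1 = spNum g z.1 * ((spFactor g z)⁻¹).1 := fun z => by
    rw [Matrix.coe_units_inv]
    rfl
  simp only [e]
  exact h1.matrix_mul h3

/-- The density of the invariant measure with respect to Lebesgue measure. -/
noncomputable def siegelDensity (z : SiegelSpace n) : ENNReal :=
  ENNReal.ofReal ((imPart z.1).det ^ (-((n : ℤ) + 1)))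

theorem measurable_siegelDensity : Measurable (siegelDensity (n := n)) := by
  have h : Continuous fun z : SiegelSpace n => (imPart z.1).det :=
    (continuous_imPart.comp SiegelSpace.continuous_val).matrix_det
  exact (h.zpow₀ _ fun z => Or.inl z.2.2.det_pos.ne').measurable.ennreal_ofReal

theorem lintegral_siegelMeasure {F : SiegelSpace n → ENNReal} (hF : Measurable F) :
    ∫⁻ z, F z ∂(siegelMeasure n) = ∫⁻ z, siegelDensity z * F z ∂(siegelLebesgue n) :=
  lintegral_withDensity_eq_lintegral_mul _ measurable_siegelDensity hF

/-- The Jacobian `|det(Cz + D)|^{-2(n+1)}` is exactly what the density `det y^{-n-1}` gains under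
the action. -/
theorem lintegral_spAct_siegelMeasure (g : SpR n) {F : SiegelSpace n → ENNReal}
    (hF : Measurable F) :
    ∫⁻ z, F (spAct g z) ∂(siegelMeasure n) = ∫⁻ z, F z ∂(siegelMeasure n) := by
  have himg : (fun c => symCoord n ((toC g.1.toBlocks₁₁ * symMat n c + toC g.1.toBlocks₁₂) *
      (toC g.1.toBlocks₂₁ * symMat n c + toC g.1.toBlocks₂₂)⁻¹)) ''
        Set.range (siegelCoord (n := n)) = Set.range (siegelCoord (n := n)) := by
    have e : ∀ z : SiegelSpace n, symCoord n ((toC g.1.toBlocks₁₁ * symMat n (siegelCoord z) +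
        toC g.1.toBlocks₁₂) * (toC g.1.toBlocks₂₁ * symMat n (siegelCoord z) +
        toC g.1.toBlocks₂₂)⁻¹) = siegelCoord (spAct g z) := fun z =>
      (siegelCoord_eq_symCoord (spAct g z)).symm
    ext c
    constructor
    · rintro ⟨_, ⟨z, rfl⟩, rfl⟩
      exact ⟨spAct g z, (e z).symm⟩
    · rintro ⟨z, rfl⟩
      refine ⟨_, ⟨spAct g⁻¹ z, rfl⟩, ?_⟩
      simp only
      rw [e, ← spAct_mul, mul_inv_cancel, spAct_one]
  let G : (Sym2 (Fin n) → ℂ) → ENNReal :=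
    Function.extend siegelCoord (fun z : SiegelSpace n => siegelDensity z * F z) 0
  have hG : ∀ z : SiegelSpace n, G (siegelCoord z) = siegelDensity z * F z :=
    fun z => (siegelCoord_injective n).extend_apply _ _ z
  have h1 := (SpR.isSymplecticBlocks g).lintegral_image (det_spDen_ne_zero g) G
  rw [himg, ← lintegral_siegelLebesgue] at h1
  simp only [hG] at h1
  rw [lintegral_siegelMeasure hF, h1]
  refine (lintegral_siegelMeasure (hF.comp (continuous_spAct g).measurable)).trans ?_
  refine lintegral_congr fun z => ?_
  change _ = ENNReal.ofReal ((‖(spDen g z.1).det‖ ^ 2) ^ (-((n : ℤ) + 1))) *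
    G (symCoord n (spAct g z).1)
  rw [← siegelCoord_eq_symCoord, hG, ← mul_assoc]
  congr 1
  rw [siegelDensity, siegelDensity, ← ENNReal.ofReal_mul (by positivity), ← mul_zpow,
    det_imPart_spAct]

theorem measurePreserving_spAct (g : SpR n) :
    MeasurePreserving (spAct g) (siegelMeasure n) (siegelMeasure n) := by
  refine ⟨(continuous_spAct g).measurable, Measure.ext fun s hs => ?_⟩
  have h := lintegral_spAct_siegelMeasure g (F := s.indicator 1) (measurable_one.indicator hs)
  rw [lintegral_indicator_one hs] at h
  rw [Measure.map_apply (continuous_spAct g).measurable hs, ← h,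
    ← lintegral_indicator_one ((continuous_spAct g).measurable hs)]
  rfl

end Action

/-! ### The representation on `H²(ρ)` -/

section Slash

variable {n : ℕ} {V : Type*} [NormedAddCommGroup V] [InnerProductSpace ℂ V]
  {ρ : Representation ℂ (GL (Fin n) ℂ) V}

theorem slash_mul (f : SiegelSpace n → V) (g h : SpR n) :
    slash ρ (slash ρ f g) h = slash ρ f (g * h) := by
  funext z
  simp only [slash, spFactor_mul, spAct_mul, _root_.mul_inv_rev, map_mul, Module.End.mul_apply]

theorem slash_one (f : SiegelSpace n → V) : slash ρ f 1 = f := by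
  funext z
  simp [slash, spFactor_one, spAct_one]

theorem slash_add (f f' : SiegelSpace n → V) (g : SpR n) :
    slash ρ (f + f') g = slash ρ f g + slash ρ f' g := by
  funext z
  simp [slash]

theorem slash_smul (c : ℂ) (f : SiegelSpace n → V) (g : SpR n) :
    slash ρ (c • f) g = c • slash ρ f g := by
  funext z
  simp [slash]

/-- Equal Gram matrices mean that `a b⁻¹` is unitary, so the pulled-back form depends on `a` only
through `aᴴa`. -/
theorem IsUnitaryOnUn.inner_map_eq (hunit : IsUnitaryOnUn ρ) {a b : GL (Fin n) ℂ}
    (h : a.1ᴴ * a.1 = b.1ᴴ * b.1) (x y : V) :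
    inner ℂ (ρ a x) (ρ a y) = inner ℂ (ρ b x) (ρ b y) := by
  have hb : b.1 * b⁻¹.1 = 1 := congrArg Units.val (mul_inv_cancel b)
  have hb' : (b⁻¹.1)ᴴ * b.1ᴴ = 1 := by rw [← conjTranspose_mul, hb, conjTranspose_one]
  have hu : (a * b⁻¹).1 ∈ unitaryGroup (Fin n) ℂ := by
    rw [mem_unitaryGroup_iff', star_eq_conjTranspose, Units.val_mul, conjTranspose_mul]
    calc (b⁻¹.1)ᴴ * a.1ᴴ * (a.1 * b⁻¹.1) = (b⁻¹.1)ᴴ * (a.1ᴴ * a.1) * b⁻¹.1 := by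
          simp only [mul_assoc]
      _ = ((b⁻¹.1)ᴴ * b.1ᴴ) * (b.1 * b⁻¹.1) := by rw [h]; simp only [mul_assoc]
      _ = 1 := by rw [hb, hb', mul_one]
  have e : ∀ x, ρ a x = ρ (a * b⁻¹) (ρ b x) := fun x => by
    rw [← Module.End.mul_apply, ← map_mul, inv_mul_cancel_right]
  rw [e x, e y, hunit _ hu]

theorem sqrtIm_conjTranspose (z : SiegelSpace n) : (sqrtIm z).1ᴴ = (sqrtIm z).1 := by
  change (toC (CFC.sqrt (imPart z.1)))ᴴ = toC (CFC.sqrt (imPart z.1))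
  have h2 : (CFC.sqrt (imPart z.1))ᴴ = CFC.sqrt (imPart z.1) :=
    (CFC.sqrt_nonneg (imPart z.1)).posSemidef.isHermitian
  conv_rhs => rw [← h2]
  ext r s
  simp [toC]

theorem sqrtIm_mul_self (z : SiegelSpace n) : (sqrtIm z).1 * (sqrtIm z).1 = toC (imPart z.1) := by
  change toC (CFC.sqrt (imPart z.1)) * toC (CFC.sqrt (imPart z.1)) = _
  rw [← toC_mul, CFC.sqrt_mul_sqrt_self _ z.2.2.posSemidef.nonneg]

theorem conjTranspose_mul_self_sqrtIm_mul_inv_spFactor (g : SpR n) (z : SiegelSpace n) :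
    (sqrtIm z * (spFactor g z)⁻¹).1ᴴ * (sqrtIm z * (spFactor g z)⁻¹).1 =
      (sqrtIm (spAct g z)).1ᴴ * (sqrtIm (spAct g z)).1 := by
  have hJ : (spFactor g z).1 * ((spFactor g z)⁻¹).1 = 1 :=
    congrArg Units.val (mul_inv_cancel (spFactor g z))
  have hJ' : (((spFactor g z)⁻¹).1)ᴴ * (spFactor g z).1ᴴ = 1 := by
    rw [← conjTranspose_mul, hJ, conjTranspose_one]
  have h1 := spDen_conjTranspose_mul_imPart g z
  change (spFactor g z).1ᴴ * _ * (spFactor g z).1 = _ at h1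
  rw [sqrtIm_conjTranspose, sqrtIm_mul_self, Units.val_mul, conjTranspose_mul,
    sqrtIm_conjTranspose]
  calc (((spFactor g z)⁻¹).1)ᴴ * (sqrtIm z).1 * ((sqrtIm z).1 * ((spFactor g z)⁻¹).1)
      = (((spFactor g z)⁻¹).1)ᴴ * ((sqrtIm z).1 * (sqrtIm z).1) * ((spFactor g z)⁻¹).1 := by
        simp only [mul_assoc]
    _ = ((((spFactor g z)⁻¹).1)ᴴ * (spFactor g z).1ᴴ) * toC (imPart (spAct g z).1) *
        ((spFactor g z).1 * ((spFactor g z)⁻¹).1) := by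
        rw [sqrtIm_mul_self, ← h1]; simp only [mul_assoc]
    _ = toC (imPart (spAct g z).1) := by rw [hJ, hJ', one_mul, mul_one]

theorem inner_weighted_slash (hunit : IsUnitaryOnUn ρ) (f f' : SiegelSpace n → V) (g : SpR n)
    (z : SiegelSpace n) :
    inner ℂ (weighted ρ (slash ρ f g) z) (weighted ρ (slash ρ f' g) z) =
      inner ℂ (weighted ρ f (spAct g z)) (weighted ρ f' (spAct g z)) := by
  simp only [weighted, slash, ← Module.End.mul_apply, ← map_mul]
  exact hunit.inner_map_eq (conjTranspose_mul_self_sqrtIm_mul_inv_spFactor g z) _ _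

theorem norm_weighted_slash (hunit : IsUnitaryOnUn ρ) (f : SiegelSpace n → V) (g : SpR n)
    (z : SiegelSpace n) :
    ‖weighted ρ (slash ρ f g) z‖ = ‖weighted ρ f (spAct g z)‖ := by
  rw [@norm_eq_sqrt_re_inner ℂ, inner_weighted_slash hunit, ← @norm_eq_sqrt_re_inner ℂ]

theorem isHolomorphic_of_differentiableAt {f : SiegelSpace n → V}
    {G : (Sym2 (Fin n) → ℂ) → V} (hG : ∀ z : SiegelSpace n, DifferentiableAt ℂ G (siegelCoord z))
    (h : ∀ z, G (siegelCoord z) = f z) : IsHolomorphic f := by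
  have h1 : DifferentiableOn ℂ G (Set.range (siegelCoord (n := n))) := by
    rintro _ ⟨z, rfl⟩
    exact (hG z).differentiableWithinAt
  refine h1.congr ?_
  rintro _ ⟨z, rfl⟩
  rw [(siegelCoord_injective n).extend_apply, h]

theorem IsHolomorphic.differentiableAt {f : SiegelSpace n → V} (hf : IsHolomorphic f)
    (z : SiegelSpace n) : DifferentiableAt ℂ (Function.extend siegelCoord f 0) (siegelCoord z) :=
  DifferentiableOn.differentiableAt hf ((isOpen_range_siegelCoord n).mem_nhds ⟨z, rfl⟩)

/-- An element of `H²(ρ)` from a square integrable holomorphic function. -/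
def H2.mk {f : SiegelSpace n → V} (hf : IsHolomorphic f)
    (hf' : MemLp (weighted ρ f) 2 (siegelMeasure n)) : H2 ρ :=
  (⟨f, hf, hf'⟩ : ↥(H2Submodule ρ))

theorem H2.ext {f g : H2 ρ} (h : f.1 = g.1) : f = g := Subtype.ext h

open scoped Matrix.Norms.L2Operator in
theorem DifferentiableAt.matrix_inv {E : Type*} [NormedAddCommGroup E] [NormedSpace ℂ E]
    {F : E → Matrix (Fin n) (Fin n) ℂ} {x : E} (hF : DifferentiableAt ℂ F x)
    (hdet : (F x).det ≠ 0) : DifferentiableAt ℂ (fun e => (F e)⁻¹) x :=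
  (HasFDerivAt.matrix_inv hF.hasFDerivAt hdet).differentiableAt

open scoped Matrix.Norms.L2Operator in
theorem differentiableAt_symMat_affine (C D : Matrix (Fin n) (Fin n) ℂ) (c : Sym2 (Fin n) → ℂ) :
    DifferentiableAt ℂ (fun c => C * symMat n c + D) c :=
  ((((ContinuousLinearMap.mul ℂ _ C).comp
    (LinearMap.toContinuousLinearMap (symMat n))).differentiableAt (x := c)).add_const D)

variable [FiniteDimensional ℂ V]

open scoped Matrix.Norms.L2Operator in
theorem IsHolomorphic.slash (hpoly : IsPolynomialRep ρ) {f : SiegelSpace n → V}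
    (hf : IsHolomorphic f) (g : SpR n) : IsHolomorphic (slash ρ f g) := by
  obtain ⟨R, hR, hRρ⟩ := hpoly.exists_differentiable
  let C := toC g.1.toBlocks₂₁
  let D := toC g.1.toBlocks₂₂
  let Φ : (Sym2 (Fin n) → ℂ) → (Sym2 (Fin n) → ℂ) := fun c => symCoord n
    ((toC g.1.toBlocks₁₁ * symMat n c + toC g.1.toBlocks₁₂) * (C * symMat n c + D)⁻¹)
  have hΦ : ∀ z : SiegelSpace n, Φ (siegelCoord z) = siegelCoord (spAct g z) := fun z =>
    (siegelCoord_eq_symCoord (spAct g z)).symm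
  refine isHolomorphic_of_differentiableAt
    (G := fun c => R (C * symMat n c + D)⁻¹ (Function.extend siegelCoord f 0 (Φ c))) ?_ ?_
  · intro z
    have hdet : (C * symMat n (siegelCoord z) + D).det ≠ 0 := by
      rw [symMat_siegelCoord]
      exact det_spDen_ne_zero g z
    have h1 := (differentiableAt_symMat_affine C D (siegelCoord z)).matrix_inv hdet
    have h2 : DifferentiableAt ℂ Φ (siegelCoord z) :=
      ((SpR.isSymplecticBlocks g).hasFDerivAt (siegelCoord z) hdet).differentiableAt
    have h3 : DifferentiableAt ℂ (Function.extend siegelCoord f 0) (Φ (siegelCoord z)) := by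
      rw [hΦ]
      exact hf.differentiableAt _
    exact (hR.differentiableAt.comp _ h1).clm_apply (h3.comp _ h2)
  · intro z
    rw [hΦ, (siegelCoord_injective n).extend_apply]
    have h4 : (C * symMat n (siegelCoord z) + D)⁻¹ = ((spFactor g z)⁻¹).1 :=
      (Matrix.coe_units_inv (spFactor g z)).symm
    rw [h4, hRρ]
    rfl

theorem memLp_weighted_slash (hpoly : IsPolynomialRep ρ) (hunit : IsUnitaryOnUn ρ)
    {f : SiegelSpace n → V} (hf : IsHolomorphic f)
    (hf' : MemLp (weighted ρ f) 2 (siegelMeasure n)) (g : SpR n) :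
    MemLp (weighted ρ (slash ρ f g)) 2 (siegelMeasure n) := by
  have h1 := hf'.comp_measurePreserving (measurePreserving_spAct g)
  refine h1.congr_norm ?_ (Filter.Eventually.of_forall fun z =>
    (norm_weighted_slash hunit f g z).symm)
  exact (hpoly.continuous_weighted (hf.slash hpoly g).continuous).aestronglyMeasurable

/-- The operator `f ↦ f|_ρ g` on `H²(ρ)`. -/
noncomputable def H2.slash (hpoly : IsPolynomialRep ρ) (hunit : IsUnitaryOnUn ρ) (g : SpR n) :
    H2 ρ →ₗ[ℂ] H2 ρ where
  toFun f := H2.mk (f.2.1.slash hpoly g) (memLp_weighted_slash hpoly hunit f.2.1 f.2.2 g)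
  map_add' f f' := H2.ext (slash_add f.1 f'.1 g)
  map_smul' c f := H2.ext (slash_smul c f.1 g)

theorem H2.slash_val (hpoly : IsPolynomialRep ρ) (hunit : IsUnitaryOnUn ρ) (g : SpR n)
    (f : H2 ρ) : (H2.slash hpoly hunit g f).1 = _root_.slash ρ f.1 g := rfl

theorem H2.inner_slash (hpoly : IsPolynomialRep ρ) (hunit : IsUnitaryOnUn ρ) (g : SpR n)
    (f f' : H2 ρ) :
    inner ℂ (H2.slash hpoly hunit g f) (H2.slash hpoly hunit g f') = inner ℂ f f' := by
  rw [H2_inner_def, H2_inner_def]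
  simp only [H2.slash_val, inner_weighted_slash hunit]
  have hmp := measurePreserving_spAct g
  have h := integral_map (f := fun z => inner ℂ (weighted ρ f.1 z) (weighted ρ f'.1 z))
    hmp.measurable.aemeasurable (by
      rw [hmp.map_eq]
      exact (integrable_inner_weighted ρ f f').aestronglyMeasurable)
  rw [hmp.map_eq] at h
  exact h.symm

/-- The operator `f ↦ f|_ρ g⁻¹` as an isometry of `H²(ρ)`. -/
noncomputable def H2.slashIsometry (hpoly : IsPolynomialRep ρ) (hunit : IsUnitaryOnUn ρ)
    (g : SpR n) : H2 ρ ≃ₗᵢ[ℂ] H2 ρ where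
  toLinearEquiv :=
    { H2.slash hpoly hunit g⁻¹ with
      invFun := H2.slash hpoly hunit g
      left_inv := fun f => H2.ext (by
        change _root_.slash ρ (_root_.slash ρ f.1 g⁻¹) g = f.1
        rw [slash_mul, inv_mul_cancel, slash_one])
      right_inv := fun f => H2.ext (by
        change _root_.slash ρ (_root_.slash ρ f.1 g) g⁻¹ = f.1
        rw [slash_mul, mul_inv_cancel, slash_one]) }
  norm_map' f := by
    change ‖H2.slash hpoly hunit g⁻¹ f‖ = ‖f‖
    rw [@norm_eq_sqrt_re_inner ℂ, H2.inner_slash, ← @norm_eq_sqrt_re_inner ℂ]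

/-- The representation `π_ρ(g) f = f|_ρ g⁻¹` on `H²(ρ)`. -/
noncomputable def slashRep (hpoly : IsPolynomialRep ρ) (hunit : IsUnitaryOnUn ρ) :
    SpR n →* (H2 ρ ≃ₗᵢ[ℂ] H2 ρ) where
  toFun := H2.slashIsometry hpoly hunit
  map_one' := LinearIsometryEquiv.ext fun f => H2.ext (by
    change _root_.slash ρ f.1 1⁻¹ = f.1
    rw [inv_one, slash_one])
  map_mul' g h := LinearIsometryEquiv.ext fun f => H2.ext (by
    change _root_.slash ρ f.1 (g * h)⁻¹ = _root_.slash ρ (_root_.slash ρ f.1 h⁻¹) g⁻¹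
    rw [slash_mul, _root_.mul_inv_rev])

theorem slashRep_apply (hpoly : IsPolynomialRep ρ) (hunit : IsUnitaryOnUn ρ) (g : SpR n)
    (f : H2 ρ) : (slashRep hpoly hunit g f).1 = slash ρ f.1 g⁻¹ := rfl

end Slash

/-! ### The functions `f_{1,v}` -/

section LowestType

variable {n : ℕ}

theorem cayleyFactor_val (z : SiegelSpace n) :
    (cayleyFactor z).1 = (1 / (2 * Complex.I)) • (z.1 + Complex.I • 1) := rfl

theorem cayleyFactor_val_eq_mul_add (z : SiegelSpace n) :
    (cayleyFactor z).1 = ((1 / (2 * Complex.I)) • (1 : Matrix (Fin n) (Fin n) ℂ)) * z.1 +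
      (1 / 2 : ℂ) • 1 := by
  rw [cayleyFactor_val, smul_add, smul_smul, smul_mul_assoc, one_mul]
  congr 2
  field_simp

/-- Both summands on the right are positive semidefinite. Hence each becomes a contraction after
normalization by the Cayley factor: the first bounds `y^{1/2}((z + i)/2i)⁻¹`, the second the Cayley
coordinate of `z`. -/
theorem conjTranspose_cayleyFactor_mul_self (z : SiegelSpace n) :
    (cayleyFactor z).1ᴴ * (cayleyFactor z).1 = toC (imPart z.1) +
      (1 / 4 : ℂ) • ((z.1 - Complex.I • 1)ᴴ * (z.1 - Complex.I • 1)) := by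
  have h := sub_conjTranspose_of_isSymm z.2.1
  have hy : toC (imPart z.1) = (-Complex.I / 2) • (z.1 - z.1ᴴ) := by
    rw [h, smul_smul]
    have : -Complex.I / 2 * (2 * Complex.I) = 1 := by
      linear_combination -Complex.I_mul_I
    rw [this, one_smul]
  have hc : (1 / (2 * Complex.I) : ℂ) = -Complex.I / 2 := by
    field_simp
    linear_combination Complex.I_sq
  have hs : star (-Complex.I / 2 : ℂ) = Complex.I / 2 := by
    simp
  rw [hy, cayleyFactor_val, hc, conjTranspose_smul, hs]
  simp only [conjTranspose_add, conjTranspose_sub, conjTranspose_smul, conjTranspose_one,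
    Complex.star_def, Complex.conj_I, add_mul, mul_add, sub_mul, mul_sub, smul_mul_assoc,
    mul_smul_comm, mul_one, one_mul]
  match_scalars
  · linear_combination (-1 / 4 : ℂ) * Complex.I_sq
  · linear_combination (Complex.I / 4) * Complex.I_sq
  · linear_combination (-Complex.I / 4) * Complex.I_sq
  · linear_combination (Complex.I ^ 2 / 4) * Complex.I_sq

theorem conjTranspose_mul_mul_inv_self (X Y : Matrix (Fin n) (Fin n) ℂ) (g : GL (Fin n) ℂ)
    (h : g.1ᴴ * g.1 = Y + X) :
    1 - (g⁻¹.1)ᴴ * Y * g⁻¹.1 = (g⁻¹.1)ᴴ * X * g⁻¹.1 := by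
  have hg : g.1 * g⁻¹.1 = 1 := congrArg Units.val (mul_inv_cancel g)
  have hg' : (g⁻¹.1)ᴴ * g.1ᴴ = 1 := by rw [← conjTranspose_mul, hg, conjTranspose_one]
  have e : (g⁻¹.1)ᴴ * (Y + X) * g⁻¹.1 = 1 := by
    rw [← h, ← mul_assoc, hg', one_mul, hg]
  rw [← e]
  noncomm_ring

theorem posSemidef_one_sub_sqrtIm_mul_inv_cayleyFactor (z : SiegelSpace n) :
    (1 - (sqrtIm z * (cayleyFactor z)⁻¹).1ᴴ * (sqrtIm z * (cayleyFactor z)⁻¹).1).PosSemidef := by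
  have e : (sqrtIm z * (cayleyFactor z)⁻¹).1ᴴ * (sqrtIm z * (cayleyFactor z)⁻¹).1 =
      ((cayleyFactor z)⁻¹.1)ᴴ * toC (imPart z.1) * (cayleyFactor z)⁻¹.1 := by
    rw [Units.val_mul, conjTranspose_mul, sqrtIm_conjTranspose, ← sqrtIm_mul_self]
    simp only [mul_assoc]
  rw [e, conjTranspose_mul_mul_inv_self _ _ _ (conjTranspose_cayleyFactor_mul_self z)]
  refine PosSemidef.conjTranspose_mul_mul_same ?_ _
  exact (posSemidef_conjTranspose_mul_self _).smul (by norm_num [Complex.le_def])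

theorem norm_entry_mul_inv_cayleyFactor_le (z : SiegelSpace n) (r s : Fin n) :
    ‖((z.1 - Complex.I • 1) * (cayleyFactor z)⁻¹.1) r s‖ ≤ 2 := by
  set w := (z.1 - Complex.I • 1) * (cayleyFactor z)⁻¹.1 with hw
  have h1 := conjTranspose_mul_mul_inv_self _ _ _
    ((conjTranspose_cayleyFactor_mul_self z).trans (add_comm _ _))
  have h2 : ((cayleyFactor z)⁻¹.1)ᴴ * ((1 / 4 : ℂ) • ((z.1 - Complex.I • 1)ᴴ *
      (z.1 - Complex.I • 1))) * (cayleyFactor z)⁻¹.1 = (1 / 4 : ℂ) • (wᴴ * w) := by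
    rw [hw, conjTranspose_mul, mul_smul_comm, smul_mul_assoc]
    simp only [mul_assoc]
  rw [h2] at h1
  have h3 : (1 - (1 / 4 : ℂ) • (wᴴ * w)).PosSemidef := by
    rw [h1]
    exact (posDef_toC z.2.2).posSemidef.conjTranspose_mul_mul_same _
  have h5 := (Complex.nonneg_iff.1 (h3.diag_nonneg (i := s))).1
  have h6 : (wᴴ * w) s s = ((∑ k, ‖w k s‖ ^ 2 : ℝ) : ℂ) := by
    rw [mul_apply, Complex.ofReal_sum]
    refine Finset.sum_congr rfl fun k _ => ?_
    rw [conjTranspose_apply, ← starRingEnd_apply, Complex.conj_mul']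
    norm_cast
  have h8 : ((1 - (1 / 4 : ℂ) • (wᴴ * w)) s s).re = 1 - 1 / 4 * ∑ k, ‖w k s‖ ^ 2 := by
    rw [Matrix.sub_apply, one_apply_eq, Matrix.smul_apply, h6, smul_eq_mul]
    rw [show (1 / 4 : ℂ) = ((1 / 4 : ℝ) : ℂ) by norm_num, ← Complex.ofReal_mul, Complex.sub_re,
      Complex.ofReal_re, Complex.one_re]
  rw [h8] at h5
  have h7 := Finset.single_le_sum (f := fun k => ‖w k s‖ ^ 2) (fun k _ => by positivity)
    (Finset.mem_univ r)
  nlinarith [norm_nonneg (w r s)]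

/-- The Cayley transform rescaled to `z ↦ 2i(z - i)(z + i)⁻¹`. With this normalization the blocks
are symplectic and the denominator is precisely `cayleyFactor`. -/
theorem cayley_isSymplecticBlocks : IsSymplecticBlocks (1 : Matrix (Fin n) (Fin n) ℂ)
    (-Complex.I • 1) ((1 / (2 * Complex.I)) • 1) ((1 / 2 : ℂ) • 1) := by
  refine ⟨by simp, by
    rw [transpose_smul, transpose_smul, transpose_one, smul_mul_smul_comm, smul_mul_smul_comm,
      mul_comm (-Complex.I)], ?_⟩
  simp only [transpose_one, transpose_smul, one_mul, smul_mul_smul_comm, mul_one, ← sub_smul]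
  rw [show (1 / 2 : ℂ) - 1 / (2 * Complex.I) * -Complex.I = 1 by field_simp; norm_num, one_smul]

/-- The integrand is the Jacobian of the rescaled Cayley transform, so the integral is the volume of
its image, which lies in a ball of radius `2`. -/
theorem lintegral_det_cayleyFactor_lt_top :
    ∫⁻ z : SiegelSpace n, ENNReal.ofReal ((‖(cayleyFactor z).1.det‖ ^ 2) ^ (-((n : ℤ) + 1)))
      ∂(siegelLebesgue n) < ⊤ := by
  have h := (cayley_isSymplecticBlocks (n := n)).lintegral_image (fun z => by
    rw [← cayleyFactor_val_eq_mul_add]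
    exact (cayleyFactor z).det_ne_zero) 1
  simp only [← cayleyFactor_val_eq_mul_add, Pi.one_apply, mul_one] at h
  rw [← h, lintegral_const, one_mul, Measure.restrict_apply_univ]
  refine (measure_mono ?_).trans_lt
    (measure_closedBall_lt_top (x := (0 : Sym2 (Fin n) → ℂ)) (r := 2))
  rintro _ ⟨_, ⟨z, rfl⟩, rfl⟩
  rw [mem_closedBall_zero_iff, pi_norm_le_iff_of_nonneg (by norm_num)]
  intro p
  induction p using Sym2.ind with
  | _ r s =>
    simp only [symMat_siegelCoord, ← cayleyFactor_val_eq_mul_add]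
    have e : (1 * z.1 + -Complex.I • 1) * (cayleyFactor z).1⁻¹ =
        (z.1 - Complex.I • 1) * (cayleyFactor z)⁻¹.1 := by
      rw [one_mul, Matrix.coe_units_inv, neg_smul, sub_eq_add_neg]
    rw [symCoord_apply, e, norm_div]
    have h1 := norm_entry_mul_inv_cayleyFactor_le z r s
    have h2 := norm_entry_mul_inv_cayleyFactor_le z s r
    have h3 := norm_add_le (((z.1 - Complex.I • 1) * (cayleyFactor z)⁻¹.1) r s)
      (((z.1 - Complex.I • 1) * (cayleyFactor z)⁻¹.1) s r)
    rw [Complex.norm_ofNat, div_le_iff₀ (by norm_num)]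
    linarith

theorem norm_det_sqrtIm_mul_inv_cayleyFactor_sq (z : SiegelSpace n) :
    ‖(sqrtIm z * (cayleyFactor z)⁻¹).1.det‖ ^ 2 =
      (imPart z.1).det / ‖(cayleyFactor z).1.det‖ ^ 2 := by
  have h1 := congrArg norm (congrArg det (sqrtIm_mul_self z))
  rw [det_mul, norm_mul, det_toC, Complex.norm_real, Real.norm_of_nonneg z.2.2.det_pos.le] at h1
  rw [Units.val_mul, det_mul, norm_mul, mul_pow, sq ‖(sqrtIm z).1.det‖, h1, Matrix.coe_units_inv,
    det_nonsing_inv, Ring.inverse_eq_inv', norm_inv, inv_pow, div_eq_mul_inv]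

variable {V : Type*} [NormedAddCommGroup V] [InnerProductSpace ℂ V]
  {ρ : Representation ℂ (GL (Fin n) ℂ) V}

theorem siegelF_one_apply (v : V) (z : SiegelSpace n) :
    siegelF ρ 1 v z = ρ (cayleyFactor z)⁻¹ v := by
  simp [siegelF]

variable [FiniteDimensional ℂ V]

open scoped Matrix.Norms.L2Operator in
theorem isHolomorphic_siegelF_one (hpoly : IsPolynomialRep ρ) (v : V) :
    IsHolomorphic (siegelF ρ 1 v) := by
  obtain ⟨R, hR, hRρ⟩ := hpoly.exists_differentiable
  refine isHolomorphic_of_differentiableAt (G := fun c =>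
    R (((1 / (2 * Complex.I)) • (1 : Matrix (Fin n) (Fin n) ℂ)) * symMat n c +
      (1 / 2 : ℂ) • 1)⁻¹ v) ?_ ?_
  · intro z
    have hdet : (((1 / (2 * Complex.I)) • (1 : Matrix (Fin n) (Fin n) ℂ)) *
        symMat n (siegelCoord z) + (1 / 2 : ℂ) • 1).det ≠ 0 := by
      rw [symMat_siegelCoord, ← cayleyFactor_val_eq_mul_add]
      exact (cayleyFactor z).det_ne_zero
    exact (hR.differentiableAt.comp _ ((differentiableAt_symMat_affine _ _ _).matrix_inv
      hdet)).clm_apply (differentiableAt_const v)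
  · intro z
    rw [siegelF_one_apply, symMat_siegelCoord, ← cayleyFactor_val_eq_mul_add,
      ← Matrix.coe_units_inv, hRρ]

/-- For the contraction `g = y^{1/2}((z + i)/2i)⁻¹` the squared norm is at most `C²|det
g|^{2(n+1)}`. The powers of `det y` in this bound cancel the density and leave the integrable
Jacobian of the Cayley transform. -/
theorem memLp_weighted_siegelF_one (hirr : ρ.IsIrreducible) (hpoly : IsPolynomialRep ρ)
    (hunit : IsUnitaryOnUn ρ) {ω : Fin n → ℤ} (hω : ∀ r, (n : ℤ) + 1 ≤ ω r) {vtop : V}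
    (htop : IsHighestWeightVector ρ ω vtop) (v : V) :
    MemLp (weighted ρ (siegelF ρ 1 v)) 2 (siegelMeasure n) := by
  have hcont := hpoly.continuous_weighted (isHolomorphic_siegelF_one hpoly v).continuous
  rw [memLp_two_iff_integrable_sq_norm hcont.aestronglyMeasurable]
  refine ⟨(hcont.norm.pow 2).aestronglyMeasurable, ?_⟩
  have hmeas : Measurable fun z => ENNReal.ofReal (‖weighted ρ (siegelF ρ 1 v) z‖ ^ 2) :=
    (hcont.norm.pow 2).measurable.ennreal_ofReal
  rw [hasFiniteIntegral_iff_ofReal (Filter.Eventually.of_forall fun z => by positivity),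
    lintegral_siegelMeasure hmeas]
  obtain ⟨C, hC0, hC⟩ := exists_norm_le_of_contraction hirr hpoly hunit hω htop v
  have hle : ∀ z : SiegelSpace n, siegelDensity z *
      ENNReal.ofReal (‖weighted ρ (siegelF ρ 1 v) z‖ ^ 2) ≤ ENNReal.ofReal (C ^ 2) *
        ENNReal.ofReal ((‖(cayleyFactor z).1.det‖ ^ 2) ^ (-((n : ℤ) + 1))) := by
    intro z
    have hy := z.2.2.det_pos
    have hd : 0 < ‖(cayleyFactor z).1.det‖ := norm_pos_iff.2 (cayleyFactor z).det_ne_zero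
    rw [siegelDensity, ← ENNReal.ofReal_mul (by positivity), ← ENNReal.ofReal_mul (by positivity)]
    refine ENNReal.ofReal_le_ofReal ?_
    have h1 := hC _ (posSemidef_one_sub_sqrtIm_mul_inv_cayleyFactor z)
    rw [map_mul, Module.End.mul_apply, ← siegelF_one_apply] at h1
    change ‖weighted ρ (siegelF ρ 1 v) z‖ ≤ _ at h1
    have h2 := pow_le_pow_left₀ (norm_nonneg _) h1 2
    rw [mul_pow, ← zpow_natCast (_ ^ ((n : ℤ) + 1)), zpow_comm, zpow_natCast,
      norm_det_sqrtIm_mul_inv_cayleyFactor_sq] at h2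
    calc (imPart z.1).det ^ (-((n : ℤ) + 1)) * ‖weighted ρ (siegelF ρ 1 v) z‖ ^ 2
        ≤ (imPart z.1).det ^ (-((n : ℤ) + 1)) * (C ^ 2 * ((imPart z.1).det /
          ‖(cayleyFactor z).1.det‖ ^ 2) ^ ((n : ℤ) + 1)) :=
          mul_le_mul_of_nonneg_left h2 (by positivity)
      _ = C ^ 2 * (‖(cayleyFactor z).1.det‖ ^ 2) ^ (-((n : ℤ) + 1)) := by
          rw [div_zpow, _root_.zpow_neg, _root_.zpow_neg]
          have : (imPart z.1).det ^ ((n : ℤ) + 1) ≠ 0 := zpow_ne_zero _ hy.ne'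
          field_simp
  refine (lintegral_mono hle).trans_lt ?_
  rw [lintegral_const_mul' _ _ ENNReal.ofReal_ne_top]
  exact ENNReal.mul_lt_top ENNReal.ofReal_lt_top lintegral_det_cayleyFactor_lt_top

/-- The linear map `v ↦ f_{1,v}` into `H²(ρ)`. -/
noncomputable def lowestType (hpoly : IsPolynomialRep ρ)
    (h : ∀ v, MemLp (weighted ρ (siegelF ρ 1 v)) 2 (siegelMeasure n)) : V →ₗ[ℂ] H2 ρ where
  toFun v := H2.mk (isHolomorphic_siegelF_one hpoly v) (h v)
  map_add' v w := H2.ext (funext fun z => by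
    change siegelF ρ 1 (v + w) z = siegelF ρ 1 v z + siegelF ρ 1 w z
    simp only [siegelF_one_apply, map_add])
  map_smul' c v := H2.ext (funext fun z => by
    change siegelF ρ 1 (c • v) z = c • siegelF ρ 1 v z
    simp only [siegelF_one_apply, map_smul])

end LowestType

/-! ### The maximal compact subgroup -/

section MaximalCompact

variable {n : ℕ}

theorem toC_neg (X : Matrix (Fin n) (Fin n) ℝ) : toC (-X) = -toC X := by
  ext r s
  simp [toC]

theorem conjTranspose_toC (X : Matrix (Fin n) (Fin n) ℝ) : (toC X)ᴴ = (toC X)ᵀ := by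
  ext r s
  simp [toC]

/-- The symplectic matrix attached to a unitary matrix `u`, with `Ci + D = u`. -/
noncomputable def unitaryToSp (u : Matrix (Fin n) (Fin n) ℂ) (hu : u ∈ unitaryGroup (Fin n) ℂ) :
    SpR n :=
  ⟨fromBlocks (u.map Complex.re) (-imPart u) (imPart u) (u.map Complex.re), by
    have h := mem_unitaryGroup_iff'.1 hu
    have hsplit : u = toC (u.map Complex.re) + Complex.I • toC (imPart u) := by
      ext r s
      simp only [toC, imPart, Matrix.add_apply, Matrix.smul_apply, Matrix.map_apply, smul_eq_mul]
      rw [mul_comm]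
      exact (Complex.re_add_im (u r s)).symm
    rw [SymplecticGroup.fromBlocks_mem_iff]
    set a := u.map Complex.re
    set b := imPart u
    -- The real and imaginary parts of `uᴴu = 1` are the symplectic relations for the blocks `(a,
    -- -b; b, a)`.
    have h1 : toC (aᵀ * a + bᵀ * b) + Complex.I • toC (aᵀ * b - bᵀ * a) = 1 := by
      rw [← h, star_eq_conjTranspose, hsplit, conjTranspose_add, conjTranspose_smul,
        conjTranspose_toC, conjTranspose_toC, sub_eq_add_neg, toC_add, toC_add, toC_neg, toC_mul,
        toC_mul, toC_mul, toC_mul]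
      simp only [Complex.star_def, Complex.conj_I, add_mul, mul_add, smul_mul_assoc,
        mul_smul_comm, toC, transpose_map]
      match_scalars <;> first | linear_combination Complex.I_sq | ring
    have h2 : aᵀ * a + bᵀ * b = 1 := by
      ext r s
      have := congrArg Complex.re (congrFun (congrFun h1 r) s)
      simpa [toC, Matrix.one_apply, apply_ite Complex.re] using this
    have h3 : aᵀ * b - bᵀ * a = 0 := by
      ext r s
      have := congrArg Complex.im (congrFun (congrFun h1 r) s)
      simpa [toC, Matrix.one_apply, apply_ite Complex.im] using this
    have h4 := sub_eq_zero.1 h3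
    refine ⟨h4, ?_, ?_⟩
    · rw [transpose_neg, neg_mul, mul_neg, h4]
    · rw [mul_neg, sub_neg_eq_add, h2]⟩

theorem spDen_unitaryToSp {u : Matrix (Fin n) (Fin n) ℂ} (hu : u ∈ unitaryGroup (Fin n) ℂ)
    (z : Matrix (Fin n) (Fin n) ℂ) :
    spDen (unitaryToSp u hu) z = toC (imPart u) * z + toC (u.map Complex.re) := rfl

theorem spNum_unitaryToSp {u : Matrix (Fin n) (Fin n) ℂ} (hu : u ∈ unitaryGroup (Fin n) ℂ)
    (z : Matrix (Fin n) (Fin n) ℂ) :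
    spNum (unitaryToSp u hu) z = toC (u.map Complex.re) * z - toC (imPart u) := by
  rw [sub_eq_add_neg, ← toC_neg]
  rfl

theorem spFactor_unitaryToSp_siegelBase {u : Matrix (Fin n) (Fin n) ℂ}
    (hu : u ∈ unitaryGroup (Fin n) ℂ) :
    (spFactor (unitaryToSp u hu) (siegelBase n)).1 = u := by
  change toC (imPart u) * (Complex.I • 1) + toC (u.map Complex.re) = u
  ext r s
  rw [mul_smul_comm, mul_one]
  simp only [toC, imPart, Matrix.add_apply, Matrix.smul_apply, Matrix.map_apply, smul_eq_mul]
  rw [mul_comm, add_comm]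
  exact Complex.re_add_im (u r s)

/-- The block structure of the elements of the maximal compact subgroup. -/
theorem blocks_of_mem_maxCompact {k : SpR n} (hk : k ∈ maxCompact n) :
    k.1.toBlocks₂₂ = k.1.toBlocks₁₁ ∧ k.1.toBlocks₁₂ = -k.1.toBlocks₂₁ := by
  have h1 : k.1ᵀ * k.1 = 1 := (mem_orthogonalGroup_iff' _ _).1 hk
  have h2 : k.1 * J (Fin n) ℝ * k.1ᵀ = J (Fin n) ℝ := SymplecticGroup.mem_iff.1 k.2
  -- A matrix both orthogonal and symplectic commutes with `J`, which is the asserted block shape.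
  have h3 : k.1 * J (Fin n) ℝ = J (Fin n) ℝ * k.1 := by
    calc k.1 * J (Fin n) ℝ = (k.1 * J (Fin n) ℝ * k.1ᵀ) * k.1 := by
          rw [mul_assoc _ _ k.1, h1, mul_one]
      _ = _ := by rw [h2]
  rw [← fromBlocks_toBlocks k.1, J, fromBlocks_multiply, fromBlocks_multiply] at h3
  simp only [mul_zero, zero_mul, mul_one, one_mul, mul_neg, neg_mul, zero_add, add_zero] at h3
  obtain ⟨h4, h5, -, -⟩ := fromBlocks_inj.1 h3
  exact ⟨(neg_injective h5).symm, h4⟩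

variable {V : Type*} [NormedAddCommGroup V] [InnerProductSpace ℂ V]
  {ρ : Representation ℂ (GL (Fin n) ℂ) V}

/-- When `A = D` and `B = -C`, one has `Az + B + i(Cz + D) = (Ci + D)(z + i)`. This is why the
functions `f_{1,v}` are permuted by `K`, with `K` acting on `v` through `Ci + D`. -/
theorem cayleyFactor_spAct_mul {k : SpR n} (h1 : k.1.toBlocks₂₂ = k.1.toBlocks₁₁)
    (h2 : k.1.toBlocks₁₂ = -k.1.toBlocks₂₁) (z : SiegelSpace n) :
    cayleyFactor (spAct k z) * spFactor k z = spFactor k (siegelBase n) * cayleyFactor z := by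
  apply Units.ext
  change (1 / (2 * Complex.I)) • ((spAct k z).1 + Complex.I • 1) * spDen k z.1 =
    spDen k (Complex.I • 1) * (1 / (2 * Complex.I)) • (z.1 + Complex.I • 1)
  rw [smul_mul_assoc, mul_smul_comm, add_mul, spAct_val_mul_spDen, spNum, spDen, spDen, h1, h2,
    toC_neg]
  congr 1
  simp only [mul_add, add_mul, smul_mul_assoc, mul_smul_comm, one_mul, mul_one, smul_add,
    smul_smul, Complex.I_mul_I]
  module

theorem slash_siegelF_one {k : SpR n} (h1 : k.1.toBlocks₂₂ = k.1.toBlocks₁₁)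
    (h2 : k.1.toBlocks₁₂ = -k.1.toBlocks₂₁) (v : V) :
    slash ρ (siegelF ρ 1 v) k = siegelF ρ 1 (ρ (spFactor k (siegelBase n))⁻¹ v) := by
  funext z
  rw [slash, siegelF_one_apply, siegelF_one_apply, ← Module.End.mul_apply, ← Module.End.mul_apply,
    ← map_mul, ← map_mul, ← _root_.mul_inv_rev, ← _root_.mul_inv_rev, cayleyFactor_spAct_mul h1 h2]

theorem slash_unitaryToSp_siegelF_one (u : GL (Fin n) ℂ) (hu : u.1 ∈ unitaryGroup (Fin n) ℂ)
    (v : V) : slash ρ (siegelF ρ 1 v) (unitaryToSp u.1 hu) = siegelF ρ 1 (ρ u⁻¹ v) := by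
  have e : spFactor (unitaryToSp u.1 hu) (siegelBase n) = u :=
    Units.ext (spFactor_unitaryToSp_siegelBase hu)
  have h := slash_siegelF_one (ρ := ρ) (k := unitaryToSp u.1 hu) rfl rfl v
  rwa [e] at h

variable [FiniteDimensional ℂ V]

theorem isKFinite_lowestType (hpoly : IsPolynomialRep ρ) (hunit : IsUnitaryOnUn ρ)
    (h : ∀ v, MemLp (weighted ρ (siegelF ρ 1 v)) 2 (siegelMeasure n)) (v : V) :
    IsKFinite (slashRep hpoly hunit) (lowestType hpoly h v) := by
  have hle : Submodule.span ℂ ((fun k => slashRep hpoly hunit k (lowestType hpoly h v)) ''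
      maxCompact n) ≤ LinearMap.range (lowestType hpoly h) := by
    rw [Submodule.span_le]
    rintro _ ⟨k, hk, rfl⟩
    have hk' : k⁻¹ ∈ maxCompact n := by
      have e : (k⁻¹).1 = k.1ᵀ := by
        have h1 : k.1ᵀ * k.1 = 1 := (mem_orthogonalGroup_iff' _ _).1 hk
        have h2 : k.1 * (k⁻¹).1 = 1 := congrArg Subtype.val (mul_inv_cancel k)
        calc (k⁻¹).1 = (k.1ᵀ * k.1) * (k⁻¹).1 := by rw [h1, one_mul]
          _ = k.1ᵀ := by rw [mul_assoc, h2, mul_one]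
      change (k⁻¹).1 ∈ orthogonalGroup (Fin n ⊕ Fin n) ℝ
      rw [e]
      exact Unitary.star_mem hk
    obtain ⟨h1, h2⟩ := blocks_of_mem_maxCompact hk'
    exact ⟨_, (H2.ext (slash_siegelF_one h1 h2 v)).symm⟩
  exact Submodule.finiteDimensional_of_le hle

/-- Replacing `v` by `ρ(u)v` amounts to slashing `f_{1,v}` by the element of `K` attached to `u⁻¹`,
and slashing is isometric. This is the hypothesis of Schur's lemma. -/
theorem inner_lowestType_unitary_invariant (hpoly : IsPolynomialRep ρ) (hunit : IsUnitaryOnUn ρ)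
    (h : ∀ v, MemLp (weighted ρ (siegelF ρ 1 v)) 2 (siegelMeasure n))
    (u : GL (Fin n) ℂ) (hu : u.1 ∈ unitaryGroup (Fin n) ℂ) (x y : V) :
    inner ℂ (lowestType hpoly h (ρ u x)) (lowestType hpoly h (ρ u y)) =
      inner ℂ (lowestType hpoly h x) (lowestType hpoly h y) := by
  have hu' : (u⁻¹).1 ∈ unitaryGroup (Fin n) ℂ := by
    have e : (u⁻¹).1 = star u.1 := by
      have h1 : star u.1 * u.1 = 1 := mem_unitaryGroup_iff'.1 hu
      have h2 : u.1 * (u⁻¹).1 = 1 := congrArg Units.val (mul_inv_cancel u)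
      calc (u⁻¹).1 = (star u.1 * u.1) * (u⁻¹).1 := by rw [h1, one_mul]
        _ = star u.1 := by rw [mul_assoc, h2, mul_one]
    rw [e]
    exact Unitary.star_mem hu
  have e : ∀ x, lowestType hpoly h (ρ u x) =
      H2.slash hpoly hunit (unitaryToSp _ hu') (lowestType hpoly h x) := fun x =>
    H2.ext (by
      have := slash_unitaryToSp_siegelF_one (ρ := ρ) u⁻¹ hu' x
      rw [inv_inv] at this
      exact this.symm)
  rw [e, e, H2.inner_slash]

end MaximalCompact

/-! ### Rotations about the base point and the mean value property -/

section Rotations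

variable {n : ℕ}

/-- An arbitrary positive definite `Y` is allowed in place of `Im z`, so that the result also covers
contractions towards the base point, which do not come from the symplectic group. -/
theorem siegel_mem_of_relations {N M Y : Matrix (Fin n) (Fin n) ℂ} (hY : Y.PosDef)
    (e1 : Nᵀ * M = Mᵀ * N) (e2 : Nᴴ * M - Mᴴ * N = (2 * Complex.I) • Y) :
    N.det ≠ 0 ∧ (M * N⁻¹).IsSymm ∧ (imPart (M * N⁻¹)).PosDef := by
  have hdet : N.det ≠ 0 := by
    intro h
    obtain ⟨x, hx0, hx⟩ := Matrix.exists_mulVec_eq_zero_iff.2 h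
    have h2 := congrArg (fun M => star x ⬝ᵥ (M *ᵥ x)) e2
    have h3 : star x ᵥ* Nᴴ = 0 := by rw [← star_mulVec, hx, star_zero]
    simp only [sub_mulVec, ← mulVec_mulVec, dotProduct_sub, hx, mulVec_zero, dotProduct_zero,
      dotProduct_mulVec _ Nᴴ, h3, zero_dotProduct, sub_self, smul_mulVec,
      dotProduct_smul, smul_eq_mul] at h2
    have h4 := hY.dotProduct_mulVec_pos hx0
    have h5 : (2 * Complex.I) ≠ 0 := by simp
    exact (mul_ne_zero h5 h4.ne') h2.symm
  have hu : IsUnit N.det := isUnit_iff_ne_zero.2 hdet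
  have hN := Matrix.mul_nonsing_inv _ hu
  have hNT : (N⁻¹)ᵀ * Nᵀ = 1 := by rw [← transpose_mul, hN, transpose_one]
  have hNH : (N⁻¹)ᴴ * Nᴴ = 1 := by rw [← conjTranspose_mul, hN, conjTranspose_one]
  have hs : (M * N⁻¹).IsSymm := by
    have a : (N⁻¹)ᵀ * (Nᵀ * M) * N⁻¹ = (N⁻¹)ᵀ * (Mᵀ * N) * N⁻¹ := by rw [e1]
    rw [← mul_assoc, hNT, one_mul, mul_assoc, mul_assoc, hN, mul_one] at a
    rw [Matrix.IsSymm, transpose_mul]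
    exact a.symm
  refine ⟨hdet, hs, posDef_of_toC ?_⟩
  have b := sub_conjTranspose_of_isSymm hs
  have c : M * N⁻¹ - (M * N⁻¹)ᴴ = (2 * Complex.I) • ((N⁻¹)ᴴ * Y * N⁻¹) := by
    have : (N⁻¹)ᴴ * (Nᴴ * M - Mᴴ * N) * N⁻¹ =
        ((N⁻¹)ᴴ * Nᴴ) * (M * N⁻¹) - ((N⁻¹)ᴴ * Mᴴ) * (N * N⁻¹) := by noncomm_ring
    rw [hN, hNH, one_mul, mul_one, ← conjTranspose_mul, e2] at this
    rw [← this]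
    simp
  rw [c] at b
  have d := smul_right_injective _ (show (2 * Complex.I) ≠ 0 by simp) b
  change (N⁻¹)ᴴ * Y * N⁻¹ = _ at d
  rw [← d]
  refine hY.conjTranspose_mul_mul_same ?_
  apply Matrix.mulVec_injective_of_isUnit
  exact (Matrix.isUnit_nonsing_inv_iff).2 ((Matrix.isUnit_iff_isUnit_det _).2 hu)

/-- The denominator of the rotation by `q` about the base point. -/
noncomputable def rotDen (q : ℂ) (z : Matrix (Fin n) (Fin n) ℂ) : Matrix (Fin n) (Fin n) ℂ :=
  (1 / (2 * Complex.I)) • ((z + Complex.I • 1) - q • (z - Complex.I • 1))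

/-- The numerator of the rotation by `q` about the base point. -/
noncomputable def rotNum (q : ℂ) (z : Matrix (Fin n) (Fin n) ℂ) : Matrix (Fin n) (Fin n) ℂ :=
  (1 / 2 : ℂ) • ((z + Complex.I • 1) + q • (z - Complex.I • 1))

theorem one_div_two_mul_I : (1 / (2 * Complex.I) : ℂ) = -Complex.I / 2 := by
  field_simp
  linear_combination Complex.I_sq

/-- The Hermitian relation holds with `Y = y + (1 - |q|²)/4 · (z - i)ᴴ(z - i)`, which remains
positive definite as long as `|q| ≤ 1`. -/
theorem rot_mem {q : ℂ} (hq : ‖q‖ ≤ 1) (z : SiegelSpace n) :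
    (rotDen q z.1).det ≠ 0 ∧ (rotNum q z.1 * (rotDen q z.1)⁻¹).IsSymm ∧
      (imPart (rotNum q z.1 * (rotDen q z.1)⁻¹)).PosDef := by
  have h := conjTranspose_cayleyFactor_mul_self z
  rw [cayleyFactor_val] at h
  have hs : star (-Complex.I / 2 : ℂ) = Complex.I / 2 := by simp
  have hY : (toC (imPart z.1) + ((1 - star q * q) * (1 / 4 : ℂ)) •
      ((z.1 - Complex.I • 1)ᴴ * (z.1 - Complex.I • 1))).PosDef := by
    refine (posDef_toC z.2.2).add_posSemidef ?_
    refine (posSemidef_conjTranspose_mul_self _).smul ?_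
    have h1 : star q * q = ((‖q‖ ^ 2 : ℝ) : ℂ) := by
      rw [← starRingEnd_apply, Complex.conj_mul']
      norm_cast
    have h2 : (1 - star q * q) * (1 / 4 : ℂ) = (((1 - ‖q‖ ^ 2) * (1 / 4) : ℝ) : ℂ) := by
      rw [h1]
      push_cast
      ring
    rw [h2]
    have h3 : ‖q‖ ^ 2 ≤ 1 := pow_le_one₀ (norm_nonneg _) hq
    exact Complex.zero_le_real.2 (by nlinarith)
  refine siegel_mem_of_relations hY ?_ ?_
  · rw [rotDen, rotNum]
    simp only [transpose_smul, transpose_add, transpose_sub, transpose_one, z.2.1.eq, add_mul,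
      mul_add, sub_mul, mul_sub, smul_mul_assoc, mul_smul_comm, mul_one, one_mul]
    match_scalars <;> ring
  · have h4 : toC (imPart z.1) = (1 / 4 : ℂ) • ((z.1 + Complex.I • 1)ᴴ * (z.1 + Complex.I • 1)) -
        (1 / 4 : ℂ) • ((z.1 - Complex.I • 1)ᴴ * (z.1 - Complex.I • 1)) := by
      rw [eq_sub_of_add_eq h.symm, one_div_two_mul_I, conjTranspose_smul, hs, smul_mul_smul_comm]
      congr 2
      linear_combination (-1 / 4 : ℂ) * Complex.I_sq
    rw [h4, rotDen, rotNum, one_div_two_mul_I]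
    generalize z.1 + Complex.I • 1 = a
    generalize z.1 - Complex.I • 1 = b
    simp only [conjTranspose_smul, conjTranspose_add, conjTranspose_sub, hs, add_mul,
      mul_add, sub_mul, mul_sub, smul_mul_assoc, mul_smul_comm]
    have hs2 : star (1 / 2 : ℂ) = 1 / 2 := by simp
    rw [hs2]
    match_scalars <;> ring

end Rotations

/-! ### Rotations by `e^{iθ}` as scalar unitary elements of `K` -/

section MeanValue

variable {n : ℕ}

/-- The scalar matrix `e^{-iθ/2}`. -/
noncomputable def rotGL (n : ℕ) (θ : ℝ) : GL (Fin n) ℂ :=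
  GeneralLinearGroup.scalar (Fin n) (Units.mk0 (Complex.exp (-(θ / 2 * Complex.I)))
    (Complex.exp_ne_zero _))

theorem rotGL_val (θ : ℝ) :
    (rotGL n θ).1 = Complex.exp (-(θ / 2 * Complex.I)) • (1 : Matrix (Fin n) (Fin n) ℂ) := by
  rw [rotGL, GeneralLinearGroup.coe_scalar, smul_one_eq_diagonal]
  rfl

theorem conj_exp_half (θ : ℝ) : (starRingEnd ℂ) (Complex.exp (-(θ / 2 * Complex.I))) =
    Complex.exp (θ / 2 * Complex.I) := by
  rw [← Complex.exp_conj]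
  simp [map_ofNat]

theorem rotGL_mem_unitaryGroup (θ : ℝ) : (rotGL n θ).1 ∈ unitaryGroup (Fin n) ℂ := by
  rw [mem_unitaryGroup_iff', star_eq_conjTranspose, rotGL_val, conjTranspose_smul,
    conjTranspose_one, smul_mul_smul_comm, mul_one, Complex.star_def, conj_exp_half,
    ← Complex.exp_add, add_neg_cancel, Complex.exp_zero, one_smul]

/-- The rotation by `e^{iθ}` about the base point. -/
noncomputable def rotSp (n : ℕ) (θ : ℝ) : SpR n :=
  unitaryToSp (rotGL n θ).1 (rotGL_mem_unitaryGroup θ)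

theorem toC_re_rotGL (θ : ℝ) : toC ((rotGL n θ).1.map Complex.re) =
    ((Complex.exp (-(θ / 2 * Complex.I))).re : ℂ) • (1 : Matrix (Fin n) (Fin n) ℂ) := by
  rw [rotGL_val]
  ext r s
  by_cases h : r = s <;> simp [toC, h]

theorem toC_im_rotGL (θ : ℝ) : toC (imPart (rotGL n θ).1) =
    ((Complex.exp (-(θ / 2 * Complex.I))).im : ℂ) • (1 : Matrix (Fin n) (Fin n) ℂ) := by
  rw [rotGL_val]
  ext r s
  by_cases h : r = s <;> simp [toC, imPart, h]

/-- The half angle makes `Ci + D` equal to `e^{-iθ/2}`. Once this constant is split off, the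
automorphy factor depends only on `q = e^{iθ}`, and holomorphically so, which permits extension to
the disc. -/
theorem spDen_rotSp (θ : ℝ) (z : Matrix (Fin n) (Fin n) ℂ) :
    spDen (rotSp n θ) z = (rotGL n θ).1 * rotDen (circleMap 0 1 θ) z := by
  have h1 := conj_exp_half θ
  have h2 : circleMap 0 1 θ = Complex.exp (θ / 2 * Complex.I) * Complex.exp (θ / 2 * Complex.I) := by
    rw [circleMap_zero, ← Complex.exp_add, Complex.ofReal_one, one_mul]
    congr 1
    ring
  have h3 : Complex.exp (θ / 2 * Complex.I) * Complex.exp (-(θ / 2 * Complex.I)) = 1 := by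
    rw [← Complex.exp_add, add_neg_cancel, Complex.exp_zero]
  rw [rotSp, spDen_unitaryToSp, toC_re_rotGL, toC_im_rotGL, rotGL_val, rotDen, h2,
    one_div_two_mul_I]
  generalize Complex.exp (-(θ / 2 * Complex.I)) = w at *
  generalize Complex.exp (θ / 2 * Complex.I) = ζ at *
  have h4 : (w.re : ℂ) + w.im * Complex.I = w := Complex.re_add_im w
  have h5 : (w.re : ℂ) - w.im * Complex.I = ζ := by
    rw [← h1]
    apply Complex.ext <;> simp
  simp only [smul_mul_assoc, one_mul]
  match_scalars
  · linear_combination (-Complex.I / 2) * (h4 - h5) + (w.im : ℂ) * Complex.I_sq -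
      (Complex.I / 2) * ζ * h3
  · linear_combination (1 / 2 : ℂ) * (h4 + h5) - (1 / 2 : ℂ) * ζ * h3 +
      (1 / 2 : ℂ) * (w + ζ * (ζ * w)) * Complex.I_sq

theorem spNum_rotSp (θ : ℝ) (z : Matrix (Fin n) (Fin n) ℂ) :
    spNum (rotSp n θ) z = (rotGL n θ).1 * rotNum (circleMap 0 1 θ) z := by
  have h1 := conj_exp_half θ
  have h2 : circleMap 0 1 θ = Complex.exp (θ / 2 * Complex.I) * Complex.exp (θ / 2 * Complex.I) := by
    rw [circleMap_zero, ← Complex.exp_add, Complex.ofReal_one, one_mul]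
    congr 1
    ring
  have h3 : Complex.exp (θ / 2 * Complex.I) * Complex.exp (-(θ / 2 * Complex.I)) = 1 := by
    rw [← Complex.exp_add, add_neg_cancel, Complex.exp_zero]
  rw [rotSp, spNum_unitaryToSp, toC_re_rotGL, toC_im_rotGL, rotGL_val, rotNum, h2]
  generalize Complex.exp (-(θ / 2 * Complex.I)) = w at *
  generalize Complex.exp (θ / 2 * Complex.I) = ζ at *
  have h4 : (w.re : ℂ) + w.im * Complex.I = w := Complex.re_add_im w
  have h5 : (w.re : ℂ) - w.im * Complex.I = ζ := by
    rw [← h1]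
    apply Complex.ext <;> simp
  simp only [smul_mul_assoc, one_mul]
  match_scalars
  · linear_combination (1 / 2 : ℂ) * (h4 + h5) - (1 / 2 : ℂ) * ζ * h3
  · linear_combination (Complex.I / 2) * (h4 - h5) - (w.im : ℂ) * Complex.I_sq +
      (Complex.I / 2) * ζ * h3

end MeanValue

/-! ### Mean value property and the reproducing formula at the base point -/

section Reproducing

variable {n : ℕ}

/-- The point with Cayley coordinate multiplied by `q`. -/
noncomputable def rotPoint {q : ℂ} (hq : ‖q‖ ≤ 1) (z : SiegelSpace n) : SiegelSpace n :=
  ⟨rotNum q z.1 * (rotDen q z.1)⁻¹, (rot_mem hq z).2⟩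

/-- The automorphy factor of `rotPoint`. -/
noncomputable def rotFactor {q : ℂ} (hq : ‖q‖ ≤ 1) (z : SiegelSpace n) : GL (Fin n) ℂ :=
  GeneralLinearGroup.mkOfDetNeZero (rotDen q z.1) (rot_mem hq z).1

theorem norm_circleMap_zero_one (θ : ℝ) : ‖circleMap 0 1 θ‖ ≤ 1 := by
  simp

theorem spFactor_rotSp (θ : ℝ) (z : SiegelSpace n) :
    spFactor (rotSp n θ) z = rotGL n θ * rotFactor (norm_circleMap_zero_one θ) z :=
  Units.ext (spDen_rotSp θ z.1)

theorem spAct_rotSp (θ : ℝ) (z : SiegelSpace n) :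
    spAct (rotSp n θ) z = rotPoint (norm_circleMap_zero_one θ) z := by
  apply Subtype.ext
  change spNum (rotSp n θ) z.1 * (spDen (rotSp n θ) z.1)⁻¹ =
    rotNum (circleMap 0 1 θ) z.1 * (rotDen (circleMap 0 1 θ) z.1)⁻¹
  have h2 : ∀ X : Matrix (Fin n) (Fin n) ℂ, (rotGL n θ).1 * X = X * (rotGL n θ).1 := fun X => by
    rw [rotGL_val, smul_one_mul, mul_smul_one]
  rw [spNum_rotSp, spDen_rotSp, h2, Matrix.mul_inv_rev, mul_assoc, h2, mul_assoc,
    ← Matrix.coe_units_inv (rotGL n θ), Units.inv_mul, mul_one]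

theorem rotPoint_zero (z : SiegelSpace n) (h : ‖(0 : ℂ)‖ ≤ 1) : rotPoint h z = siegelBase n := by
  apply Subtype.ext
  change rotNum 0 z.1 * (rotDen 0 z.1)⁻¹ = Complex.I • 1
  have hd := (rot_mem h z).1
  have e : rotNum 0 z.1 = (Complex.I • 1) * rotDen 0 z.1 := by
    rw [rotNum, rotDen, zero_smul, add_zero, sub_zero, smul_mul_assoc, one_mul, smul_smul]
    congr 1
    field_simp
  rw [e, mul_assoc, Matrix.mul_nonsing_inv _ (isUnit_iff_ne_zero.2 hd), mul_one]

theorem rotFactor_zero (z : SiegelSpace n) (h : ‖(0 : ℂ)‖ ≤ 1) :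
    rotFactor h z = cayleyFactor z := by
  apply Units.ext
  change rotDen 0 z.1 = (1 / (2 * Complex.I)) • (z.1 + Complex.I • 1)
  rw [rotDen, zero_smul, sub_zero]

theorem symCoord_rotNum_mul_inv {q : ℂ} (hq : ‖q‖ ≤ 1) (z : SiegelSpace n) :
    symCoord n (rotNum q z.1 * (rotDen q z.1)⁻¹) = siegelCoord (rotPoint hq z) := by
  rw [siegelCoord_eq_symCoord]
  rfl

theorem rotFactor_inv_val {q : ℂ} (hq : ‖q‖ ≤ 1) (z : SiegelSpace n) :
    ((rotFactor hq z)⁻¹).1 = (rotDen q z.1)⁻¹ :=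
  Matrix.coe_units_inv (rotFactor hq z)

theorem continuous_rotNum : Continuous fun p : ℂ × Matrix (Fin n) (Fin n) ℂ => rotNum p.1 p.2 := by
  unfold rotNum
  fun_prop

theorem continuous_rotDen : Continuous fun p : ℂ × Matrix (Fin n) (Fin n) ℂ => rotDen p.1 p.2 := by
  unfold rotDen
  fun_prop

theorem continuous_spAct_rotSp :
    Continuous fun p : ℝ × SiegelSpace n => spAct (rotSp n p.1) p.2 := by
  refine SiegelSpace.continuous_of_val ?_
  have hz : Continuous fun p : ℝ × SiegelSpace n => p.2.1 :=
    SiegelSpace.continuous_val.comp continuous_snd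
  have hq : Continuous fun p : ℝ × SiegelSpace n => circleMap 0 1 p.1 :=
    (continuous_circleMap 0 1).comp continuous_fst
  have h1 : Continuous fun p : ℝ × SiegelSpace n => rotNum (circleMap 0 1 p.1) p.2.1 :=
    continuous_rotNum.comp (hq.prodMk hz)
  have h2 : Continuous fun p : ℝ × SiegelSpace n =>
      ((rotFactor (norm_circleMap_zero_one p.1) p.2)⁻¹).1 := by
    refine GL.continuous_inv_val ?_
    change Continuous fun p : ℝ × SiegelSpace n => rotDen (circleMap 0 1 p.1) p.2.1
    exact continuous_rotDen.comp (hq.prodMk hz)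
  have e : ∀ p : ℝ × SiegelSpace n, (spAct (rotSp n p.1) p.2).1 = rotNum (circleMap 0 1 p.1) p.2.1 *
      ((rotFactor (norm_circleMap_zero_one p.1) p.2)⁻¹).1 := fun p => by
    rw [spAct_rotSp, Matrix.coe_units_inv]
    rfl
  simp only [e]
  exact h1.matrix_mul h2

variable {V : Type*} [NormedAddCommGroup V] [InnerProductSpace ℂ V]
  {ρ : Representation ℂ (GL (Fin n) ℂ) V}

/-- Moving the rotation onto both functions by the slash action produces the same scalar unitary
factor in both arguments, where it cancels. The dependence on `θ` that remains is holomorphic in `q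
= e^{iθ}` and sits in the linear argument only. -/
theorem inner_weighted_siegelF_one_spAct_rotSp (hunit : IsUnitaryOnUn ρ) (f : SiegelSpace n → V)
    (v : V) (θ : ℝ) (z : SiegelSpace n) :
    inner ℂ (weighted ρ (siegelF ρ 1 v) (spAct (rotSp n θ) z))
        (weighted ρ f (spAct (rotSp n θ) z)) =
      inner ℂ (weighted ρ (siegelF ρ 1 v) z) (ρ (sqrtIm z)
        (ρ (rotFactor (norm_circleMap_zero_one θ) z)⁻¹
          (f (rotPoint (norm_circleMap_zero_one θ) z)))) := by
  have hcomm : ∀ (g : GL (Fin n) ℂ) (x : V),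
      ρ g (ρ (rotGL n θ)⁻¹ x) = ρ (rotGL n θ)⁻¹ (ρ g x) := fun g x => by
    rw [← Module.End.mul_apply, ← Module.End.mul_apply, ← map_mul, ← map_mul]
    have h : rotGL n θ * g = g * rotGL n θ := GeneralLinearGroup.scalar_commute _ _
    have h' : Commute (rotGL n θ) g := h
    rw [h'.inv_left.eq]
  have hu : ((rotGL n θ)⁻¹).1 ∈ unitaryGroup (Fin n) ℂ := by
    have e : ((rotGL n θ)⁻¹).1 = star (rotGL n θ).1 := by
      have h1 : star (rotGL n θ).1 * (rotGL n θ).1 = 1 :=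
        mem_unitaryGroup_iff'.1 (rotGL_mem_unitaryGroup θ)
      have h2 : (rotGL n θ).1 * (rotGL n θ)⁻¹.1 = 1 := congrArg Units.val (mul_inv_cancel _)
      calc ((rotGL n θ)⁻¹).1 = (star (rotGL n θ).1 * (rotGL n θ).1) * (rotGL n θ)⁻¹.1 := by
            rw [h1, one_mul]
        _ = star (rotGL n θ).1 := by rw [mul_assoc, h2, mul_one]
    rw [e]
    exact Unitary.star_mem (rotGL_mem_unitaryGroup θ)
  rw [← inner_weighted_slash hunit]
  have e1 : weighted ρ (slash ρ (siegelF ρ 1 v) (rotSp n θ)) z =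
      ρ (rotGL n θ)⁻¹ (weighted ρ (siegelF ρ 1 v) z) := by
    rw [rotSp, slash_unitaryToSp_siegelF_one, weighted, weighted, siegelF_one_apply,
      siegelF_one_apply, hcomm, hcomm]
  have e2 : weighted ρ (slash ρ f (rotSp n θ)) z =
      ρ (rotGL n θ)⁻¹ (ρ (sqrtIm z) (ρ (rotFactor (norm_circleMap_zero_one θ) z)⁻¹
        (f (rotPoint (norm_circleMap_zero_one θ) z)))) := by
    rw [weighted, slash, spFactor_rotSp, spAct_rotSp, _root_.mul_inv_rev, map_mul,
      Module.End.mul_apply, hcomm, hcomm]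
  rw [e1, e2, hunit _ hu]

variable [FiniteDimensional ℂ V]

open scoped Matrix.Norms.L2Operator in
/-- The mean value property of holomorphic functions with respect to rotations about the base
point. -/
theorem circleAverage_rot (hpoly : IsPolynomialRep ρ) {f : SiegelSpace n → V}
    (hf : IsHolomorphic f) (z : SiegelSpace n) (ℓ : V →L[ℂ] ℂ) :
    (2 * Real.pi)⁻¹ • ∫ θ in (0)..(2 * Real.pi), ℓ (ρ (rotFactor (norm_circleMap_zero_one θ) z)⁻¹
      (f (rotPoint (norm_circleMap_zero_one θ) z))) =
    ℓ (siegelF ρ 1 (f (siegelBase n)) z) := by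
  obtain ⟨R, hR, hRρ⟩ := hpoly.exists_differentiable
  -- The integrand with `e^{iθ}` replaced by a point `q` of the disc. It is complex differentiable
  -- at every point of the closed disc, and at the centre the rotated point is `iI` and the factor
  -- is `cayleyFactor z`.
  let h : ℂ → ℂ := fun q => ℓ (R (rotDen q z.1)⁻¹ (Function.extend siegelCoord f 0
    (symCoord n (rotNum q z.1 * (rotDen q z.1)⁻¹))))
  have hval : ∀ {q : ℂ} (hq : ‖q‖ ≤ 1), h q = ℓ (ρ (rotFactor hq z)⁻¹ (f (rotPoint hq z))) := by
    intro q hq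
    change ℓ (R (rotDen q z.1)⁻¹ (Function.extend siegelCoord f 0
      (symCoord n (rotNum q z.1 * (rotDen q z.1)⁻¹)))) = _
    rw [symCoord_rotNum_mul_inv hq, (siegelCoord_injective n).extend_apply, ← rotFactor_inv_val hq,
      hRρ]
  have hdiff : ∀ q : ℂ, ‖q‖ ≤ 1 → DifferentiableAt ℂ h q := by
    intro q hq
    have h1 : DifferentiableAt ℂ (fun q => rotDen q z.1) q := by
      unfold rotDen
      fun_prop
    have h2 : DifferentiableAt ℂ (fun q => rotNum q z.1) q := by
      unfold rotNum
      fun_prop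
    have h3 := h1.matrix_inv (rot_mem hq z).1
    have h4 : DifferentiableAt ℂ (fun q => symCoord n (rotNum q z.1 * (rotDen q z.1)⁻¹)) q :=
      (LinearMap.toContinuousLinearMap (symCoord n)).differentiableAt.comp q (h2.mul h3)
    have h5 : DifferentiableAt ℂ (Function.extend siegelCoord f 0)
        (symCoord n (rotNum q z.1 * (rotDen q z.1)⁻¹)) := by
      rw [symCoord_rotNum_mul_inv hq]
      exact hf.differentiableAt _
    have h6 : DifferentiableAt ℂ (fun q => Function.extend siegelCoord f 0
        (symCoord n (rotNum q z.1 * (rotDen q z.1)⁻¹))) q :=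
      DifferentiableAt.comp (g := Function.extend siegelCoord f 0) q h5 h4
    have h7 : DifferentiableAt ℂ (fun q => R (rotDen q z.1)⁻¹) q := hR.differentiableAt.comp q h3
    exact DifferentiableAt.comp (g := ℓ) q ℓ.differentiableAt (h7.clm_apply h6)
  have hcl : DiffContOnCl ℂ h (Metric.ball 0 |1|) := by
    refine DifferentiableOn.diffContOnCl fun q hq => (hdiff q ?_).differentiableWithinAt
    have := Metric.closure_ball_subset_closedBall hq
    simpa using this
  have havg := hcl.circleAverage
  rw [Real.circleAverage_def] at havg
  have h0 : ‖(0 : ℂ)‖ ≤ 1 := by simp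
  rw [hval h0, rotPoint_zero, rotFactor_zero, ← siegelF_one_apply] at havg
  rw [← havg]
  congr 1
  refine intervalIntegral.integral_congr fun θ _ => ?_
  exact (hval (norm_circleMap_zero_one θ)).symm

/-- Invariance of the measure makes the integral of the rotated integrand independent of the angle.
After Fubini the mean over the angle can be taken pointwise, where it replaces `f` by `f_{1,f(iI)}`.
-/
theorem inner_lowestType_eq (hpoly : IsPolynomialRep ρ) (hunit : IsUnitaryOnUn ρ)
    (h : ∀ v, MemLp (weighted ρ (siegelF ρ 1 v)) 2 (siegelMeasure n)) (v : V) (f : H2 ρ) :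
    inner ℂ (lowestType hpoly h v) f =
      inner ℂ (lowestType hpoly h v) (lowestType hpoly h (f.1 (siegelBase n))) := by
  let Θ : SiegelSpace n → ℂ := fun z => inner ℂ (weighted ρ (siegelF ρ 1 v) z) (weighted ρ f.1 z)
  have hΘ : Integrable Θ (siegelMeasure n) := integrable_inner_weighted ρ (lowestType hpoly h v) f
  have hrot : ∀ θ, ∫ z, Θ (spAct (rotSp n θ) z) ∂(siegelMeasure n) =
      ∫ z, Θ z ∂(siegelMeasure n) := fun θ => by
    have hmp := measurePreserving_spAct (rotSp n θ)
    have h := integral_map (f := Θ) hmp.measurable.aemeasurable (by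
      rw [hmp.map_eq]
      exact hΘ.aestronglyMeasurable)
    rw [hmp.map_eq] at h
    exact h.symm
  let ν : Measure ℝ := volume.restrict (Set.Ioc 0 (2 * Real.pi))
  have hprod : Integrable (fun p : ℝ × SiegelSpace n => Θ (spAct (rotSp n p.1) p.2))
      (ν.prod (siegelMeasure n)) := by
    -- The shear `(θ, z) ↦ (θ, rotSp θ · z)` preserves the product measure, so integrability on the
    -- product reduces to that of `Θ`, the range of angles having finite measure.
    have hmp : MeasurePreserving (fun p : ℝ × SiegelSpace n => (p.1, spAct (rotSp n p.1) p.2))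
        (ν.prod (siegelMeasure n)) (ν.prod (siegelMeasure n)) :=
      (MeasurePreserving.id ν).skew_product continuous_spAct_rotSp.measurable
        (Filter.Eventually.of_forall fun θ => (measurePreserving_spAct (rotSp n θ)).map_eq)
    exact hmp.integrable_comp_of_integrable (hΘ.comp_snd ν)
  have hswap : ∫ θ, ∫ z, Θ (spAct (rotSp n θ) z) ∂(siegelMeasure n) ∂ν =
      ∫ z, ∫ θ, Θ (spAct (rotSp n θ) z) ∂ν ∂(siegelMeasure n) := integral_integral_swap hprod
  have hmean : ∀ z, ∫ θ, Θ (spAct (rotSp n θ) z) ∂ν = (2 * Real.pi) •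
      inner ℂ (weighted ρ (siegelF ρ 1 v) z)
        (weighted ρ (siegelF ρ 1 (f.1 (siegelBase n))) z) := fun z => by
    -- At fixed `z`, pairing with `f_{1,v}(z)` is a continuous linear functional of the other
    -- argument, so the scalar mean value property applies.
    let ℓ : V →L[ℂ] ℂ := (innerSL ℂ (weighted ρ (siegelF ρ 1 v) z)).comp
      (LinearMap.toContinuousLinearMap (ρ (sqrtIm z)))
    have h1 := circleAverage_rot hpoly f.2.1 z ℓ
    have h2 : ℓ (siegelF ρ 1 (f.1 (siegelBase n)) z) = inner ℂ (weighted ρ (siegelF ρ 1 v) z)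
        (weighted ρ (siegelF ρ 1 (f.1 (siegelBase n))) z) := rfl
    rw [← h2, ← h1, smul_smul, mul_inv_cancel₀ Real.two_pi_pos.ne', one_smul,
      intervalIntegral.integral_of_le Real.two_pi_pos.le]
    refine integral_congr_ae (Filter.Eventually.of_forall fun θ => ?_)
    exact inner_weighted_siegelF_one_spAct_rotSp hunit f.1 v θ z
  simp only [hrot, hmean] at hswap
  rw [integral_const, integral_smul] at hswap
  have hν : ν.real Set.univ = 2 * Real.pi := by
    simp [ν, Measure.real, Real.pi_nonneg]
  rw [hν] at hswap
  exact smul_right_injective ℂ Real.two_pi_pos.ne' hswap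

end Reproducing

/-! ### The matrix coefficients -/

theorem mainTheorem5 (n : ℕ) (hn : 0 < n)
    {V : Type*} [NormedAddCommGroup V] [InnerProductSpace ℂ V] [FiniteDimensional ℂ V]
    (ρ : Representation ℂ (GL (Fin n) ℂ) V)
    (hirr : ρ.IsIrreducible) (hpoly : IsPolynomialRep ρ) (hunit : IsUnitaryOnUn ρ)
    (ω : Fin n → ℤ) (hω : Antitone ω)
    (vtop : V) (htop : IsHighestWeightVector ρ ω vtop) (hnorm : ‖vtop‖ = 1)
    (hωn : (n : ℤ) < ω ⟨n - 1, Nat.sub_lt hn Nat.one_pos⟩) :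
    -- the representation `π_ρ` on `H²(ρ)` and the elements `f_{1,v}` of `H²(ρ)`
    ∃ (π : SpR n →* (H2 ρ ≃ₗᵢ[ℂ] H2 ρ)) (f₁ : V → H2 ρ),
      (∀ (g : SpR n) (f : H2 ρ), (π g f).1 = slash ρ f.1 g⁻¹) ∧
      (∀ v : V, (f₁ v).1 = siegelF ρ 1 v) ∧
      (∀ v : V, IsKFinite π (f₁ v)) ∧
      ∀ f : H2 ρ, IsKFinite π f → ∀ v : V,
        (∀ g : SpR n, matrixCoeff π f (f₁ v) g =
          ((‖f₁ vtop‖ ^ 2 : ℝ) : ℂ) * inner ℂ v (classicalLift ρ f.1 g⁻¹)) ∧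
        (∀ g : SpR n, dualMatrixCoeff π (dualVec (f₁ v)) (dualVec f) g =
          ((‖f₁ vtop‖ ^ 2 : ℝ) : ℂ) * inner ℂ v (classicalLift ρ f.1 g)) := by
  -- The index `n - 1` carries the smallest entry `ω_n`. By integrality `ω_n > n` gives the exponent
  -- `n + 1` that matches the invariant density.
  have hω' : ∀ r, (n : ℤ) + 1 ≤ ω r := fun r =>
    (Int.add_one_le_iff.2 hωn).trans (hω (Fin.mk_le_mk.2 (Nat.le_sub_one_of_lt r.2)))
  have h := memLp_weighted_siegelF_one hirr hpoly hunit hω' htop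
  let π := slashRep hpoly hunit
  let f₁ := lowestType hpoly h
  refine ⟨π, f₁, slashRep_apply hpoly hunit, fun v => rfl, isKFinite_lowestType hpoly hunit h,
    fun f _ v => ?_⟩
  obtain ⟨c, hc⟩ := exists_inner_eq_smul_of_unitary_invariant hirr hpoly hunit f₁
    (inner_lowestType_unitary_invariant hpoly hunit h)
  have hC : c = ((‖f₁ vtop‖ ^ 2 : ℝ) : ℂ) := by
    have := hc vtop vtop
    rw [inner_self_eq_norm_sq_to_K, inner_self_eq_norm_sq_to_K, hnorm] at this
    simpa using this.symm
  have hrep : ∀ f' : H2 ρ, inner ℂ (f₁ v) f' =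
      ((‖f₁ vtop‖ ^ 2 : ℝ) : ℂ) * inner ℂ v (f'.1 (siegelBase n)) := fun f' => by
    rw [← hC, ← hc]
    exact inner_lowestType_eq hpoly hunit h v f'
  have hcoeff : ∀ g : SpR n, matrixCoeff π f (f₁ v) g =
      ((‖f₁ vtop‖ ^ 2 : ℝ) : ℂ) * inner ℂ v (classicalLift ρ f.1 g⁻¹) := fun g => hrep (π g f)
  refine ⟨hcoeff, fun g => ?_⟩
  -- Writing `f` this way lets unitarity move `g` off `f_{1,v}`, reducing the dual coefficient at
  -- `g` to the first one at `g⁻¹`.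
  have hf : f = π g (π g⁻¹ f) := by
    rw [map_inv]
    exact ((π g).apply_symm_apply f).symm
  rw [dualMatrixCoeff, contragredient_dualVec, dualInner_dualVec]
  conv_lhs => rw [hf]
  rw [LinearIsometryEquiv.inner_map_map]
  have := hcoeff g⁻¹
  rwa [inv_inv] at this
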